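/- For $1\le p\le\infty$ and $\alpha\in\mathbb R$ let $L_{p,\alpha}$ be the set of measurable real functions $f$ on $[-1,1]$ with $\|f\|_{p,\alpha}:=\|f(x)(1-x^2)^\alpha\|_{L_p[-1,1]}<\infty$, and for $n\ge1$ let $$E_n(f)_{p,\alpha}=\inf_{P}\|f-P\|_{p,\alpha},$$ where $P$ runs over the algebraic polynomials of degree not greater than $n-1$. For $0\le t<\pi$ put $$\hat\tau_t(f,x)=\frac1{\pi(1-x^2)\cos^4\frac t2}\int_0^\pi B_{\cos t}(x,\cos\varphi,R)\,f(R)\,d\varphi,\qquad R=x\cos t-\sqrt{1-x^2}\,\sin t\,\cos\varphi,$$ $$B_y(x,z,R)=2\Bigl(\sqrt{1-x^2}\,y+xz\sqrt{1-y^2}+\sqrt{1-x^2}\,(1-y)(1-z^2)\Bigr)^2-(1-R^2),$$ and $\hat\tau_{-t}=\hat\tau_t$ (the operator depends only on $y=\cos t$). Define the generalised differences by $\Delta^1_{t}(f,x)=\hat\tau_t(f,x)-f(x)$ and $\Delta^r_{t_1,\dots,t_r}(f,x)=\Delta^1_{t_r}\bigl(\Delta^{r-1}_{t_1,\dots,t_{r-1}}(f,\cdot),x\bigr)$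 for $r\ge2$, and for $0<\delta<\pi$ let the $r$-th generalised modulus of smoothness be $$\hat\omega_r(f,\delta)_{p,\alpha}=\sup_{|t_j|\le\delta,\ j=1,\dots,r}\bigl\|\Delta^r_{t_1,\dots,t_r}(f,x)\bigr\|_{p,\alpha}.$$ **Theorem.** Let $1\le p\le\infty$, let $r\ge1$ be an integer, let $0<\lambda<2r$, and let $$1-\frac1{2p}<\alpha<\frac32-\frac1{2p}\quad\text{if }1\le p<\infty,\qquad 1\le\alpha<\frac32\quad\text{if }p=\infty.$$ Let $\delta_0<\pi$. There is a constant $C>0$, depending only on $p,\alpha,r,\lambda,\delta_0$, such that for every $f\in L_{p,\alpha}$ and every $M\ge0$: if $$E_n(f)_{p,\alpha}\le M n^{-\lambda}\qquad\text{for all }n=1,2,\dots,$$ then $$\hat\omega_r(f,\delta)_{p,\alpha}\le C M\delta^\lambda\qquad\text{for all }0<\delta\le\delta_0 .$$ -/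

import Mathlib

open scoped ENNReal

/-- Lebesgue measure on the segment `[-1, 1]`. -/
noncomputable def segMeasure : MeasureTheory.Measure ℝ :=
  MeasureTheory.volume.restrict (Set.Icc (-1 : ℝ) 1)

/-- The class `L_{p,α}`: functions `f` with `f(x) (1 - x²)^α ∈ L_p[-1,1]`. -/
def MemLpWeighted (p : ℝ≥0∞) (α : ℝ) (f : ℝ → ℝ) : Prop :=
  MeasureTheory.MemLp (fun x => f x * (1 - x ^ 2) ^ α) p segMeasure

/-- The norm `‖f‖_{p,α} = ‖f(x) (1 - x²)^α‖_p`, with value `∞` allowed. -/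
noncomputable def weightedNorm (p : ℝ≥0∞) (α : ℝ) (f : ℝ → ℝ) : ℝ≥0∞ :=
  MeasureTheory.eLpNorm (fun x => f x * (1 - x ^ 2) ^ α) p segMeasure

/-- The best approximation `E_n(f)_{p,α}` of `f` by algebraic polynomials of degree
not greater than `n - 1`, that is, of degree less than `n`. -/
noncomputable def bestApprox (p : ℝ≥0∞) (α : ℝ) (n : ℕ) (f : ℝ → ℝ) : ℝ≥0∞ :=
  ⨅ (P : Polynomial ℝ) (_ : P.degree < (n : WithBot ℕ)),
    weightedNorm p α (fun x => f x - P.eval x)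

/-- `R = x y - √(1-x²) √(1-y²) z`; for `y = cos t` with `0 ≤ t ≤ π` and `z = cos φ` this is
`x cos t - √(1-x²) sin t cos φ`. -/
noncomputable def shiftR (y x z : ℝ) : ℝ :=
  x * y - √(1 - x ^ 2) * √(1 - y ^ 2) * z

/-- The kernel `B_y(x, z, R)`. -/
noncomputable def shiftB (y x z R : ℝ) : ℝ :=
  2 * (√(1 - x ^ 2) * y + x * z * √(1 - y ^ 2) + √(1 - x ^ 2) * (1 - y) * (1 - z ^ 2)) ^ 2
    - (1 - R ^ 2)

/-- The asymmetric generalised shift operator with step `t` (an even function of `t`). -/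
noncomputable def genShift (t : ℝ) (f : ℝ → ℝ) (x : ℝ) : ℝ :=
  1 / (Real.pi * (1 - x ^ 2) * Real.cos (t / 2) ^ 4) *
    ∫ φ in (0 : ℝ)..Real.pi,
      shiftB (Real.cos t) x (Real.cos φ) (shiftR (Real.cos t) x (Real.cos φ)) *
        f (shiftR (Real.cos t) x (Real.cos φ))

/-- The generalised difference of order `r` with steps `t_1, …, t_r`: the step `t_r` is
applied last, and the difference of order one is `genShift t f - f`. -/
noncomputable def genDiff : (r : ℕ) → (Fin r → ℝ) → (ℝ → ℝ) → ℝ → ℝ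
  | 0, _, f => f
  | r + 1, t, f => fun x =>
      genShift (t (Fin.last r)) (genDiff r (fun j => t j.castSucc) f) x
        - genDiff r (fun j => t j.castSucc) f x

/-- The generalised modulus of smoothness of order `r`, with value `∞` allowed. -/
noncomputable def genModulus (p : ℝ≥0∞) (α : ℝ) (r : ℕ) (f : ℝ → ℝ) (δ : ℝ) : ℝ≥0∞ :=
  ⨆ (t : Fin r → ℝ) (_ : ∀ j, |t j| ≤ δ), weightedNorm p α (genDiff r t f)

/-!
The proof is the classical inverse theorem, with the geometry of the sphere supplying the bounds
on the shift.

*The shift as a circle mean.* With `x = cos θ`, the number `R` is the height of a point on the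
circle of radius `t` about a point of height `x` on the unit sphere, and the kernel is
`(1 - R²) cos 2ψ` for an angle `ψ` of a spherical triangle, hence at most `1 - R²`
(`abs_shiftB_le`). So the shift, up to the factor `π cos⁴ (t / 2)`, is dominated by the circle mean
conjugated by the weight `(1 - x²)^(α - 1)`. The circle mean is symmetric with respect to `dx`
(`lintegral_mul_circleMean_comm`), and since `1 - R² ≥ (1 - x²) sin² φ` it takes `(1 - x²)^(-s)`
to at most a multiple of itself for `0 ≤ s < 1/2` (`exists_circleMean_poleWeight_le`).
Jensen's inequality with such a weight, followed by the symmetry, bounds the shift on `L_{p,α}` in the given range of `α`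
(`exists_eLpNorm_circleMean_le`, `exists_weightedNorm_asymShift_le`).

*Differences of polynomials.* Let `Q` be a polynomial of degree at most `N`. The unnormalised shift
`asymShift y Q` is a polynomial of degree at most `N + 2` in `y = cos t` for fixed `x`, and of
degree at most `N` in `x` for fixed `y`: integration over `φ` removes everything that is odd in the square
roots (`IsEvenForm.exists_integral_eq_eval`). Thus `y ↦ asymShift y Q` is a bounded polynomial with
values in `L_{p,α}`, and Markov's inequality at the endpoint `y = 1` bounds its increment between
`1` and `cos t` by a multiple of `(N + 1)² (1 - cos t)`. Hence one difference of `Q` is smaller than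
`Q` by a factor of order `((N + 1) t)²`, and as it is again a polynomial of degree at most `N`, the
estimate iterates (`exists_weightedNorm_genDiff_polynomial_le`). No differential operator and no
Bernstein inequality in the variable `x` is needed.

*Summation.* Choose near-best polynomials `P k` of degree less than `2 ^ k` and `N` with `2 ^ N`
comparable to `1 / δ`. The remainder `f - P N` is controlled by boundedness of the differences, the
terms of `P N = P 0 + ∑ (P (k + 1) - P k)` by the polynomial estimate, and these form a geometric
sum because `λ < 2 r`; the constant `P 0` is annihilated.
-/

open MeasureTheory Set

/-! ### Spherical trigonometry of the kernel -/

/-- The three summands of `1 = R² + (…)² + (…)²` are the squared components of the unit vector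
pointing to the pole in an orthonormal frame at the end point of the arc, whose vectors are normal
to the sphere, tangent to the arc, and normal to the arc. -/
theorem one_sub_shiftR_sq_eq {x y : ℝ} (hx : x ∈ Icc (-1 : ℝ) 1) (hy : y ∈ Icc (-1 : ℝ) 1) (z : ℝ) :
    1 - shiftR y x z ^ 2 =
      (x * √(1 - y ^ 2) + √(1 - x ^ 2) * y * z) ^ 2 + (1 - x ^ 2) * (1 - z ^ 2) := by
  have hu : √(1 - x ^ 2) ^ 2 = 1 - x ^ 2 := Real.sq_sqrt (by nlinarith [hx.1, hx.2])
  have hw : √(1 - y ^ 2) ^ 2 = 1 - y ^ 2 := Real.sq_sqrt (by nlinarith [hy.1, hy.2])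
  unfold shiftR
  generalize √(1 - x ^ 2) = u at *
  generalize √(1 - y ^ 2) = w at *
  linear_combination (-z ^ 2 * w ^ 2 - y ^ 2 * z ^ 2) * hu + (-z ^ 2 * (1 - x ^ 2) - x ^ 2) * hw

theorem one_sub_sq_mul_le_one_sub_shiftR_sq {x y : ℝ} (hx : x ∈ Icc (-1 : ℝ) 1)
    (hy : y ∈ Icc (-1 : ℝ) 1) (z : ℝ) :
    (1 - x ^ 2) * (1 - z ^ 2) ≤ 1 - shiftR y x z ^ 2 := by
  rw [one_sub_shiftR_sq_eq hx hy]
  nlinarith [sq_nonneg (x * √(1 - y ^ 2) + √(1 - x ^ 2) * y * z)]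

/-- The kernel is `(1 - R²) cos 2ψ`, where `√(1 - R²) cos ψ` is the quantity squared in
`shiftB`; the other leg `√(1 - R²) sin ψ` appears explicitly in the proof. -/
theorem abs_shiftB_le {x y z : ℝ} (hx : x ∈ Icc (-1 : ℝ) 1) (hy : y ∈ Icc (-1 : ℝ) 1)
    (hz : z ∈ Icc (-1 : ℝ) 1) :
    |shiftB y x z (shiftR y x z)| ≤ 1 - shiftR y x z ^ 2 := by
  have hu : √(1 - x ^ 2) ^ 2 = 1 - x ^ 2 := Real.sq_sqrt (by nlinarith [hx.1, hx.2])
  have key : 1 - shiftR y x z ^ 2 =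
      (√(1 - x ^ 2) * y + x * z * √(1 - y ^ 2) + √(1 - x ^ 2) * (1 - y) * (1 - z ^ 2)) ^ 2 +
      (1 - z ^ 2) * (x * √(1 - y ^ 2) + √(1 - x ^ 2) * y * z - √(1 - x ^ 2) * z) ^ 2 := by
    rw [one_sub_shiftR_sq_eq hx hy]
    generalize √(1 - x ^ 2) = u at *
    linear_combination (z ^ 2 - 1) * hu
  have hM : 0 ≤ (1 - z ^ 2) *
      (x * √(1 - y ^ 2) + √(1 - x ^ 2) * y * z - √(1 - x ^ 2) * z) ^ 2 :=
    mul_nonneg (by nlinarith [hz.1, hz.2]) (sq_nonneg _)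
  unfold shiftB
  rw [abs_le]
  constructor
  · nlinarith [sq_nonneg
      (√(1 - x ^ 2) * y + x * z * √(1 - y ^ 2) + √(1 - x ^ 2) * (1 - y) * (1 - z ^ 2))]
  · linarith

theorem shiftR_one {x : ℝ} (z : ℝ) : shiftR 1 x z = x := by simp [shiftR]

theorem shiftR_neg_one {x : ℝ} (z : ℝ) : shiftR (-1) x z = -x := by simp [shiftR]

theorem continuous_shiftR (y : ℝ) : Continuous fun q : ℝ × ℝ => shiftR y q.1 (Real.cos q.2) := by
  unfold shiftR; fun_prop

theorem continuous_shiftB (y : ℝ) :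
    Continuous fun q : ℝ × ℝ => shiftB y q.1 (Real.cos q.2) (shiftR y q.1 (Real.cos q.2)) := by
  unfold shiftB shiftR; fun_prop

/-! ### The circle mean and its symmetry -/

/-- The circle mean (not normalised) of an `ℝ≥0∞`-valued function: the integral of `v(R)` over
the circle of radius `arccos y` about a point of height `x` on the unit sphere. -/
noncomputable def circleMean (y : ℝ) (v : ℝ → ℝ≥0∞) (x : ℝ) : ℝ≥0∞ :=
  ∫⁻ φ in Ioo (0 : ℝ) Real.pi, v (shiftR y x (Real.cos φ))

/-- The density of the circle mean with respect to `dR`, symmetric in `x` and `R`. Off the circle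
the radicand is not positive and the density is `0`, by the conventions for `√` and `⁻¹`. -/
noncomputable def circleDensity (y x R : ℝ) : ℝ≥0∞ :=
  ENNReal.ofReal (√(1 - x ^ 2 - y ^ 2 - R ^ 2 + 2 * x * y * R))⁻¹

theorem circleDensity_comm (y x R : ℝ) : circleDensity y x R = circleDensity y R x := by
  unfold circleDensity; congr 3; ring

theorem circleMean_eq_lintegral_density {x y : ℝ} (hx : x ∈ Ioo (-1 : ℝ) 1)
    (hy : y ∈ Ioo (-1 : ℝ) 1) (v : ℝ → ℝ≥0∞) :
    circleMean y v x = ∫⁻ R in Ioo (-1 : ℝ) 1, v R * circleDensity y x R := by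
  have hx2 : 0 < 1 - x ^ 2 := by nlinarith [hx.1, hx.2]
  have hy2 : 0 < 1 - y ^ 2 := by nlinarith [hy.1, hy.2]
  set a := √(1 - x ^ 2) * √(1 - y ^ 2) with ha
  have ha0 : 0 < a := mul_pos (Real.sqrt_pos.2 hx2) (Real.sqrt_pos.2 hy2)
  have ha2 : a ^ 2 = (1 - x ^ 2) * (1 - y ^ 2) := by
    rw [ha, mul_pow, Real.sq_sqrt hx2.le, Real.sq_sqrt hy2.le]
  set f : ℝ → ℝ := fun φ => shiftR y x (Real.cos φ) with hf
  have hfe : ∀ φ, f φ = x * y - a * Real.cos φ := fun φ => rfl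
  have hder : ∀ φ ∈ Ioo (0 : ℝ) Real.pi,
      HasDerivWithinAt f (a * Real.sin φ) (Ioo 0 Real.pi) φ := fun φ _ => by
    have := ((Real.hasDerivAt_cos φ).const_mul a).const_sub (x * y)
    simp only [mul_neg, neg_neg] at this
    exact this.hasDerivWithinAt
  have hinj : InjOn f (Ioo 0 Real.pi) := fun s hs t ht hst => by
    rw [hfe, hfe] at hst
    exact Real.injOn_cos (Ioo_subset_Icc_self hs) (Ioo_subset_Icc_self ht)
      (mul_left_cancel₀ ha0.ne' (by linarith))
  have hG : ∀ R, 1 - x ^ 2 - y ^ 2 - R ^ 2 + 2 * x * y * R = a ^ 2 - (R - x * y) ^ 2 := fun R => by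
    rw [ha2]; ring
  have himg : ∀ R, R ∉ f '' Ioo 0 Real.pi → circleDensity y x R = 0 := fun R hR => by
    have : a ^ 2 - (R - x * y) ^ 2 ≤ 0 := by
      by_contra! h
      have hlt : |(x * y - R) / a| < 1 := by
        rw [abs_div, abs_of_pos ha0, div_lt_one ha0]
        exact abs_lt_of_sq_lt_sq (by nlinarith) ha0.le
      rw [abs_lt] at hlt
      refine hR ⟨Real.arccos ((x * y - R) / a),
        ⟨Real.arccos_pos.2 hlt.2, Real.arccos_lt_pi.2 hlt.1⟩, ?_⟩
      rw [hfe, Real.cos_arccos hlt.1.le hlt.2.le]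
      field_simp
      ring
    rw [circleDensity, hG, Real.sqrt_eq_zero_of_nonpos this]; simp
  have hsub : f '' Ioo 0 Real.pi ⊆ Ioo (-1) 1 := by
    rintro _ ⟨φ, hφ, rfl⟩
    have hs := Real.sin_pos_of_pos_of_lt_pi hφ.1 hφ.2
    have h1 := one_sub_sq_mul_le_one_sub_shiftR_sq (Ioo_subset_Icc_self hx)
      (Ioo_subset_Icc_self hy) (Real.cos φ)
    have h2 : 0 < (1 - x ^ 2) * (1 - Real.cos φ ^ 2) := by
      rw [← Real.sin_sq]; positivity
    rw [mem_Ioo, ← abs_lt, hf]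
    exact (sq_lt_one_iff_abs_lt_one _).1 (by linarith)
  have hmeas : MeasurableSet (f '' Ioo 0 Real.pi) :=
    measurableSet_Ioo.image_of_continuousOn_injOn
      (fun φ hφ => (hder φ hφ).continuousWithinAt) hinj
  calc circleMean y v x
      = ∫⁻ φ in Ioo 0 Real.pi,
          ENNReal.ofReal |a * Real.sin φ| * (v (f φ) * circleDensity y x (f φ)) := by
        refine setLIntegral_congr_fun measurableSet_Ioo fun φ hφ => ?_
        have hs := Real.sin_pos_of_pos_of_lt_pi hφ.1 hφ.2
        have has : 0 < a * Real.sin φ := mul_pos ha0 hs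
        have hr : √(1 - x ^ 2 - y ^ 2 - f φ ^ 2 + 2 * x * y * f φ) = a * Real.sin φ := by
          rw [hG, hfe, ← Real.sqrt_sq has.le]
          congr 1
          linear_combination -a ^ 2 * Real.sin_sq_add_cos_sq φ
        simp only [circleDensity]
        rw [hr, abs_of_pos has, mul_left_comm, ← ENNReal.ofReal_mul has.le,
          mul_inv_cancel₀ has.ne', ENNReal.ofReal_one, mul_one]
    _ = ∫⁻ R in f '' Ioo 0 Real.pi, v R * circleDensity y x R :=
        (lintegral_image_eq_lintegral_abs_deriv_mul measurableSet_Ioo hder hinj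
          (fun R => v R * circleDensity y x R)).symm
    _ = ∫⁻ R in Ioo (-1 : ℝ) 1, v R * circleDensity y x R := by
        rw [← lintegral_indicator hmeas, ← lintegral_indicator measurableSet_Ioo]
        refine lintegral_congr fun R => ?_
        by_cases hR : R ∈ f '' Ioo 0 Real.pi
        · rw [indicator_of_mem hR, indicator_of_mem (hsub hR)]
        · rw [indicator_of_notMem hR, indicator_apply, himg R hR, mul_zero, ite_self]

theorem measurable_circleDensity (y : ℝ) :
    Measurable fun q : ℝ × ℝ => circleDensity y q.1 q.2 := by
  unfold circleDensity; fun_prop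

theorem lintegral_mul_circleMean_eq {y : ℝ} (hy : y ∈ Ioo (-1 : ℝ) 1) (u : ℝ → ℝ≥0∞)
    {v : ℝ → ℝ≥0∞} (hv : Measurable v) :
    ∫⁻ x in Ioo (-1 : ℝ) 1, u x * circleMean y v x =
      ∫⁻ x in Ioo (-1 : ℝ) 1, ∫⁻ R in Ioo (-1 : ℝ) 1, u x * (v R * circleDensity y x R) := by
  refine setLIntegral_congr_fun measurableSet_Ioo fun x hx => ?_
  have hk : Measurable fun R => circleDensity y x R := by unfold circleDensity; fun_prop
  have hm : Measurable fun R => v R * circleDensity y x R := hv.mul hk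
  change u x * circleMean y v x = ∫⁻ R in Ioo (-1 : ℝ) 1, u x * (v R * circleDensity y x R)
  rw [circleMean_eq_lintegral_density hx hy]
  exact (lintegral_const_mul _ hm).symm

theorem lintegral_mul_comp_neg_comm {u v : ℝ → ℝ≥0∞} (hu : Measurable u) (hv : Measurable v) :
    ∫⁻ x in Ioo (-1 : ℝ) 1, u x * v (-x) = ∫⁻ x in Ioo (-1 : ℝ) 1, v x * u (-x) := by
  have hmp : MeasurePreserving (fun x : ℝ => -x) (volume.restrict (Ioo (-1 : ℝ) 1))
      (volume.restrict (Ioo (-1 : ℝ) 1)) := by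
    have := (Measure.measurePreserving_neg (volume : Measure ℝ)).restrict_preimage
      (measurableSet_Ioo (a := (-1 : ℝ)) (b := 1))
    rwa [Set.neg_preimage, Set.neg_Ioo, neg_neg] at this
  have hm : Measurable fun x => v x * u (-x) := hv.mul (hu.comp measurable_neg)
  rw [← hmp.lintegral_comp hm]
  refine lintegral_congr fun x => ?_
  rw [neg_neg, mul_comm]

/-- The circle mean is symmetric on `(-1, 1)` with respect to `dx`. -/
theorem lintegral_mul_circleMean_comm {y : ℝ} (hy : y ∈ Icc (-1 : ℝ) 1) {u v : ℝ → ℝ≥0∞}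
    (hu : Measurable u) (hv : Measurable v) :
    ∫⁻ x in Ioo (-1 : ℝ) 1, u x * circleMean y v x =
      ∫⁻ x in Ioo (-1 : ℝ) 1, v x * circleMean y u x := by
  rcases eq_or_lt_of_le hy.1 with h1 | h1
  · simp only [circleMean, ← h1, shiftR_neg_one, lintegral_const, ← mul_assoc]
    rw [lintegral_mul_const _ (by fun_prop), lintegral_mul_const _ (by fun_prop),
      lintegral_mul_comp_neg_comm hu hv]
  rcases eq_or_lt_of_le hy.2 with h2 | h2
  · simp only [circleMean, h2, shiftR_one, lintegral_const]
    refine lintegral_congr fun x => ?_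
    rw [mul_left_comm]
  have hm : Measurable fun q : ℝ × ℝ => u q.1 * (v q.2 * circleDensity y q.1 q.2) :=
    (hu.comp measurable_fst).mul ((hv.comp measurable_snd).mul (measurable_circleDensity y))
  rw [lintegral_mul_circleMean_eq ⟨h1, h2⟩ u hv, lintegral_mul_circleMean_eq ⟨h1, h2⟩ v hu,
    lintegral_lintegral_swap (f := fun x R => u x * (v R * circleDensity y x R)) hm.aemeasurable]
  refine lintegral_congr fun R => lintegral_congr fun x => ?_
  rw [circleDensity_comm, mul_left_comm]

theorem measurable_circleMean (y : ℝ) {v : ℝ → ℝ≥0∞} (hv : Measurable v) :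
    Measurable (circleMean y v) :=
  (hv.comp (continuous_shiftR y).measurable).lintegral_prod_right'

theorem circleMean_const (y : ℝ) (c : ℝ≥0∞) (x : ℝ) :
    circleMean y (fun _ => c) x = c * ENNReal.ofReal Real.pi := by
  simp [circleMean]

/-! ### Negative powers of the distance to the poles -/

theorem lintegral_sin_rpow_neg_lt_top {s : ℝ} (hs : s < 1) (hs0 : 0 ≤ s) :
    ∫⁻ φ in Ioo (0 : ℝ) Real.pi, ENNReal.ofReal (Real.sin φ ^ (-s)) < ∞ := by
  have hpi := Real.pi_pos
  have h1 : IntervalIntegrable (fun φ : ℝ => φ ^ (-s)) volume 0 Real.pi :=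
    intervalIntegral.intervalIntegrable_rpow' (by linarith)
  have h2 : IntervalIntegrable (fun φ : ℝ => (Real.pi - φ) ^ (-s)) volume 0 Real.pi := by
    have := h1.comp_sub_left Real.pi
    simpa using this.symm
  have h3 : IntegrableOn (fun φ : ℝ => (2 / Real.pi) ^ (-s) * (φ ^ (-s) + (Real.pi - φ) ^ (-s)))
      (Ioo 0 Real.pi) := by
    have := (h1.add h2).const_mul ((2 / Real.pi) ^ (-s))
    rw [intervalIntegrable_iff_integrableOn_Ioo_of_le hpi.le] at this
    exact this
  refine lt_of_le_of_lt (setLIntegral_mono' measurableSet_Ioo fun φ hφ => ?_)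
    h3.lintegral_lt_top
  refine ENNReal.ofReal_le_ofReal ?_
  have hmono : ∀ t : ℝ, 0 < t → 2 / Real.pi * t ≤ Real.sin φ →
      Real.sin φ ^ (-s) ≤ (2 / Real.pi) ^ (-s) * t ^ (-s) := fun t ht h => by
    rw [← Real.mul_rpow (by positivity) ht.le]
    exact Real.rpow_le_rpow_of_nonpos (by positivity) h (by linarith)
  have hφ' : 0 < Real.pi - φ := by linarith [hφ.2]
  have hn1 : 0 ≤ φ ^ (-s) := Real.rpow_nonneg hφ.1.le _
  have hn2 : 0 ≤ (Real.pi - φ) ^ (-s) := Real.rpow_nonneg hφ'.le _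
  have hc : 0 ≤ (2 / Real.pi) ^ (-s) := by positivity
  rcases le_total φ (Real.pi / 2) with h | h
  · refine (hmono φ hφ.1 (Real.mul_le_sin hφ.1.le h)).trans ?_
    gcongr; linarith
  · refine (hmono (Real.pi - φ) hφ' ?_).trans ?_
    · rw [← Real.sin_pi_sub]
      exact Real.mul_le_sin hφ'.le (by linarith)
    · gcongr; linarith

/-- The power weight `(1 - x²)^e`, as an `ℝ≥0∞`-valued function. -/
noncomputable def poleWeight (e x : ℝ) : ℝ≥0∞ := ENNReal.ofReal ((1 - x ^ 2) ^ e)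

theorem measurable_poleWeight (e : ℝ) : Measurable (poleWeight e) := by
  unfold poleWeight; fun_prop

theorem poleWeight_zero (x : ℝ) : poleWeight 0 x = 1 := by simp [poleWeight]

theorem poleWeight_mul {x : ℝ} (hx : x ∈ Ioo (-1 : ℝ) 1) (d e : ℝ) :
    poleWeight d x * poleWeight e x = poleWeight (d + e) x := by
  have hx2 : 0 < 1 - x ^ 2 := by nlinarith [hx.1, hx.2]
  unfold poleWeight
  rw [Real.rpow_add hx2, ENNReal.ofReal_mul (by positivity)]

theorem poleWeight_rpow {x : ℝ} (hx : x ∈ Ioo (-1 : ℝ) 1) (e : ℝ) {p : ℝ} (hp : 0 ≤ p) :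
    poleWeight e x ^ p = poleWeight (e * p) x := by
  have hx2 : 0 < 1 - x ^ 2 := by nlinarith [hx.1, hx.2]
  unfold poleWeight
  rw [Real.rpow_mul hx2.le, ENNReal.ofReal_rpow_of_nonneg (by positivity) hp]

theorem shiftR_mem_Ioo {x y φ : ℝ} (hx : x ∈ Ioo (-1 : ℝ) 1) (hy : y ∈ Icc (-1 : ℝ) 1)
    (hφ : φ ∈ Ioo 0 Real.pi) : shiftR y x (Real.cos φ) ∈ Ioo (-1 : ℝ) 1 := by
  have hs := Real.sin_pos_of_pos_of_lt_pi hφ.1 hφ.2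
  have hx2 : 0 < 1 - x ^ 2 := by nlinarith [hx.1, hx.2]
  have h1 := one_sub_sq_mul_le_one_sub_shiftR_sq (Ioo_subset_Icc_self hx) hy (Real.cos φ)
  have h2 : 0 < (1 - x ^ 2) * (1 - Real.cos φ ^ 2) := by
    rw [← Real.sin_sq]; positivity
  rw [mem_Ioo, ← abs_lt]
  exact (sq_lt_one_iff_abs_lt_one _).1 (by linarith)

/-- Since `1 - R² ≥ (1 - x²) sin² φ`, a circle mean of `(1 - R²)^(-s)` is at most a multiple of
`(1 - x²)^(-s)`, uniformly in the radius, as long as `sin^(-2s)` is integrable. -/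
theorem exists_circleMean_poleWeight_le {s : ℝ} (hs0 : 0 ≤ s) (hs : s < 1 / 2) :
    ∃ C : ℝ≥0∞, C ≠ ∞ ∧ ∀ y ∈ Icc (-1 : ℝ) 1, ∀ x ∈ Ioo (-1 : ℝ) 1,
      circleMean y (poleWeight (-s)) x ≤ C * poleWeight (-s) x := by
  refine ⟨_, (lintegral_sin_rpow_neg_lt_top (s := 2 * s) (by linarith) (by linarith)).ne,
    fun y hy x hx => ?_⟩
  have hx2 : 0 < 1 - x ^ 2 := by nlinarith [hx.1, hx.2]
  rw [← lintegral_mul_const _ (by fun_prop)]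
  refine setLIntegral_mono' measurableSet_Ioo fun φ hφ => ?_
  have hsin := Real.sin_pos_of_pos_of_lt_pi hφ.1 hφ.2
  unfold poleWeight
  rw [← ENNReal.ofReal_mul (by positivity)]
  refine ENNReal.ofReal_le_ofReal ?_
  have e : Real.sin φ ^ (-(2 * s)) = (Real.sin φ ^ 2) ^ (-s) := by
    rw [← Real.rpow_natCast, ← Real.rpow_mul hsin.le]; congr 1; push_cast; ring
  rw [e, mul_comm, ← Real.mul_rpow hx2.le (by positivity)]
  refine Real.rpow_le_rpow_of_nonpos (by positivity) ?_ (by linarith)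
  rw [Real.sin_sq]
  exact one_sub_sq_mul_le_one_sub_shiftR_sq (Ioo_subset_Icc_self hx) hy (Real.cos φ)

/-! ### Null sets under the rotation -/

theorem segMeasure_eq_restrict_Ioo : segMeasure = volume.restrict (Ioo (-1 : ℝ) 1) :=
  Measure.restrict_congr_set Ioo_ae_eq_Icc.symm

instance : IsFiniteMeasure segMeasure := by
  unfold segMeasure; infer_instance

theorem ae_segMeasure_mem_Ioo : ∀ᵐ x ∂segMeasure, x ∈ Ioo (-1 : ℝ) 1 := by
  rw [segMeasure_eq_restrict_Ioo]
  exact ae_restrict_mem measurableSet_Ioo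

/-- The rotation `(x, φ) ↦ R` maps null sets of the segment back to null sets, so that circle
means do not depend on the choice of a representative. -/
theorem quasiMeasurePreserving_shiftR {y : ℝ} (hy : y ∈ Icc (-1 : ℝ) 1) :
    Measure.QuasiMeasurePreserving (fun q : ℝ × ℝ => shiftR y q.1 (Real.cos q.2))
      (segMeasure.prod (volume.restrict (Ioo 0 Real.pi))) segMeasure := by
  have hm := (continuous_shiftR y).measurable
  refine ⟨hm, Measure.AbsolutelyContinuous.mk fun s hs h0 => ?_⟩
  rw [Measure.map_apply hm hs, Measure.prod_apply (hm hs)]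
  have h1 : ∀ x, volume.restrict (Ioo 0 Real.pi)
      (Prod.mk x ⁻¹' ((fun q : ℝ × ℝ => shiftR y q.1 (Real.cos q.2)) ⁻¹' s)) =
      1 * circleMean y (s.indicator 1) x := fun x => by
    have hmx : Measurable fun φ : ℝ => shiftR y x (Real.cos φ) := by unfold shiftR; fun_prop
    rw [one_mul]
    exact (lintegral_indicator_one (hmx hs)).symm
  simp_rw [h1]
  rw [segMeasure_eq_restrict_Ioo] at h0 ⊢
  have h2 := lintegral_mul_circleMean_comm hy (measurable_const (a := (1 : ℝ≥0∞)))
    (measurable_one.indicator hs)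
  rw [h2]
  simp only [circleMean_const]
  rw [lintegral_mul_const _ (measurable_one.indicator hs), lintegral_indicator_one hs, h0,
    zero_mul]

theorem ae_ae_shiftR {y : ℝ} (hy : y ∈ Icc (-1 : ℝ) 1) {P : ℝ → Prop}
    (h : ∀ᵐ x ∂segMeasure, P x) :
    ∀ᵐ x ∂segMeasure, ∀ᵐ φ ∂volume.restrict (Ioo 0 Real.pi), P (shiftR y x (Real.cos φ)) :=
  Measure.ae_ae_of_ae_prod ((quasiMeasurePreserving_shiftR hy).ae h)

/-! ### Domination of the shift by circle means -/

/-- The shift without its normalising factor: `genShift t f` is `asymShift (cos t) f` divided by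
`π cos⁴ (t / 2)`. Unlike `genShift` it makes sense, and is uniformly bounded, for all
`y ∈ [-1, 1]`. -/
noncomputable def asymShift (y : ℝ) (f : ℝ → ℝ) (x : ℝ) : ℝ :=
  (1 - x ^ 2)⁻¹ * ∫ φ in (0 : ℝ)..Real.pi,
    shiftB y x (Real.cos φ) (shiftR y x (Real.cos φ)) * f (shiftR y x (Real.cos φ))

theorem genShift_eq_asymShift (t : ℝ) (f : ℝ → ℝ) (x : ℝ) :
    genShift t f x = (Real.pi * Real.cos (t / 2) ^ 4)⁻¹ * asymShift (Real.cos t) f x := by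
  unfold genShift asymShift
  rw [← mul_assoc, ← mul_inv, one_div]
  congr 2; ring

theorem asymShift_congr_ae {y : ℝ} (hy : y ∈ Icc (-1 : ℝ) 1) {f g : ℝ → ℝ}
    (h : f =ᵐ[segMeasure] g) : asymShift y f =ᵐ[segMeasure] asymShift y g := by
  filter_upwards [ae_ae_shiftR hy h] with x hx
  unfold asymShift
  congr 1
  rw [intervalIntegral.integral_of_le Real.pi_pos.le, intervalIntegral.integral_of_le
    Real.pi_pos.le, ← Measure.restrict_congr_set Ioo_ae_eq_Ioc]
  refine integral_congr_ae ?_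
  filter_upwards [hx] with φ hφ
  rw [hφ]

theorem aestronglyMeasurable_asymShift {y : ℝ} (hy : y ∈ Icc (-1 : ℝ) 1) {f : ℝ → ℝ}
    (hf : AEStronglyMeasurable f segMeasure) :
    AEStronglyMeasurable (asymShift y f) segMeasure := by
  have h1 : AEStronglyMeasurable (fun q : ℝ × ℝ =>
      shiftB y q.1 (Real.cos q.2) (shiftR y q.1 (Real.cos q.2)) *
        f (shiftR y q.1 (Real.cos q.2)))
      (segMeasure.prod (volume.restrict (Ioo 0 Real.pi))) :=
    (continuous_shiftB y).aestronglyMeasurable.mul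
      (hf.comp_quasiMeasurePreserving (quasiMeasurePreserving_shiftR hy))
  have h2 := h1.integral_prod_right'
  have h3 : AEStronglyMeasurable (fun x : ℝ => (1 - x ^ 2)⁻¹) segMeasure := by
    have : Measurable (fun x : ℝ => (1 - x ^ 2)⁻¹) := by fun_prop
    exact this.aestronglyMeasurable
  refine (h3.mul h2).congr (Filter.Eventually.of_forall fun x => ?_)
  unfold asymShift
  rw [intervalIntegral.integral_of_le Real.pi_pos.le, ← Measure.restrict_congr_set Ioo_ae_eq_Ioc]
  rfl

theorem enorm_shiftB_mul_le {x y : ℝ} (hx : x ∈ Ioo (-1 : ℝ) 1) (hy : y ∈ Icc (-1 : ℝ) 1) {φ : ℝ}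
    (hφ : φ ∈ Ioo 0 Real.pi) (α : ℝ) (f : ℝ → ℝ) :
    ‖shiftB y x (Real.cos φ) (shiftR y x (Real.cos φ)) * f (shiftR y x (Real.cos φ))‖ₑ ≤
      poleWeight (-(α - 1)) (shiftR y x (Real.cos φ)) *
        ‖f (shiftR y x (Real.cos φ)) * (1 - shiftR y x (Real.cos φ) ^ 2) ^ α‖ₑ := by
  have hB := abs_shiftB_le (Ioo_subset_Icc_self hx) hy ⟨Real.neg_one_le_cos φ, Real.cos_le_one φ⟩
  have hR := shiftR_mem_Ioo hx hy hφ
  set R := shiftR y x (Real.cos φ)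
  have hR2 : 0 < 1 - R ^ 2 := by nlinarith [hR.1, hR.2]
  rw [Real.enorm_eq_ofReal_abs, Real.enorm_eq_ofReal_abs, poleWeight,
    ← ENNReal.ofReal_mul (by positivity), abs_mul, abs_mul,
    abs_of_nonneg (Real.rpow_nonneg hR2.le α)]
  refine ENNReal.ofReal_le_ofReal ?_
  rw [mul_left_comm, ← Real.rpow_add hR2, mul_comm |f R|]
  refine mul_le_mul_of_nonneg_right ?_ (abs_nonneg _)
  simpa using hB

/-- The weighted shift is dominated by a circle mean conjugated by the power weight of exponent
`α - 1`, because the kernel is at most `1 - R²`. -/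
theorem enorm_asymShift_mul_le {x y : ℝ} (hx : x ∈ Ioo (-1 : ℝ) 1) (hy : y ∈ Icc (-1 : ℝ) 1)
    (α : ℝ) (f : ℝ → ℝ) :
    ‖asymShift y f x * (1 - x ^ 2) ^ α‖ₑ ≤ poleWeight (α - 1) x * circleMean y
      (fun R => poleWeight (-(α - 1)) R * ‖f R * (1 - R ^ 2) ^ α‖ₑ) x := by
  have hx2 : 0 < 1 - x ^ 2 := by nlinarith [hx.1, hx.2]
  have h1 : asymShift y f x * (1 - x ^ 2) ^ α = (1 - x ^ 2) ^ (α - 1) *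
      ∫ φ in Ioo 0 Real.pi, shiftB y x (Real.cos φ) (shiftR y x (Real.cos φ)) *
        f (shiftR y x (Real.cos φ)) := by
    unfold asymShift
    rw [intervalIntegral.integral_of_le Real.pi_pos.le,
      ← Measure.restrict_congr_set Ioo_ae_eq_Ioc, Real.rpow_sub_one hx2.ne']
    ring
  rw [h1, enorm_mul, Real.enorm_of_nonneg (by positivity)]
  refine mul_le_mul_right ((enorm_integral_le_lintegral_enorm _).trans ?_) _
  exact setLIntegral_mono' measurableSet_Ioo fun φ hφ => enorm_shiftB_mul_le hx hy hφ α f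

/-- Jensen's inequality for the measure with density `a`, in homogeneous form. -/
theorem lintegral_mul_rpow_le {X : Type*} [MeasurableSpace X] (μ : Measure X) {p : ℝ}
    (hp : 1 ≤ p) {a b : X → ℝ≥0∞} (ha : AEMeasurable a μ) (hb : AEMeasurable b μ) :
    (∫⁻ x, a x * b x ∂μ) ^ p ≤ (∫⁻ x, a x ∂μ) ^ (p - 1) * ∫⁻ x, a x * b x ^ p ∂μ := by
  rcases eq_or_lt_of_le hp with rfl | hp1
  · simp
  have hp0 : 0 < p := by linarith
  have hpq := (Real.HolderConjugate.conjExponent hp1).symm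
  set q := p.conjExponent with hq
  have hq0 : 0 < q := hpq.pos
  have h1 : ∀ x, a x * b x = ((fun x => a x ^ (1 / q)) * fun x => a x ^ (1 / p) * b x) x :=
    fun x => by
      rw [Pi.mul_apply, ← mul_assoc, ← ENNReal.rpow_add_of_nonneg _ _ (by positivity)
        (by positivity)]
      have : 1 / q + 1 / p = 1 := by simpa using hpq.inv_add_inv_eq_one
      rw [this, ENNReal.rpow_one]
  calc (∫⁻ x, a x * b x ∂μ) ^ p
      ≤ ((∫⁻ x, (a x ^ (1 / q)) ^ q ∂μ) ^ (1 / q) *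
          (∫⁻ x, (a x ^ (1 / p) * b x) ^ p ∂μ) ^ (1 / p)) ^ p := by
        gcongr
        rw [lintegral_congr h1]
        exact ENNReal.lintegral_mul_le_Lp_mul_Lq μ hpq (ha.pow_const _)
          ((ha.pow_const _).mul hb)
    _ = (∫⁻ x, a x ∂μ) ^ (p - 1) * ∫⁻ x, a x * b x ^ p ∂μ := by
        rw [ENNReal.mul_rpow_of_nonneg _ _ hp0.le, ← ENNReal.rpow_mul, ← ENNReal.rpow_mul,
          one_div_mul_cancel hp0.ne', ENNReal.rpow_one]
        congr 1
        · congr 1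
          · refine lintegral_congr fun x => ?_
            rw [← ENNReal.rpow_mul, one_div_mul_cancel hq0.ne', ENNReal.rpow_one]
          · rw [hq, Real.conjExponent]
            field_simp
        · refine lintegral_congr fun x => ?_
          rw [ENNReal.mul_rpow_of_nonneg _ _ hp0.le, ← ENNReal.rpow_mul,
            one_div_mul_cancel hp0.ne', ENNReal.rpow_one]

/-- Pointwise form of the weighted estimate: Jensen's inequality with respect to the weight
`(1 - R²)^(-s)`. -/
theorem poleWeight_mul_circleMean_rpow_le {p γ s : ℝ} (hp : 1 ≤ p) {x y : ℝ}
    (hx : x ∈ Ioo (-1 : ℝ) 1) (hy : y ∈ Icc (-1 : ℝ) 1) {C : ℝ≥0∞}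
    (hC : circleMean y (poleWeight (-s)) x ≤ C * poleWeight (-s) x) {h : ℝ → ℝ≥0∞}
    (hh : Measurable h) :
    (poleWeight γ x * circleMean y (fun R => poleWeight (-γ) R * h R) x) ^ p ≤
      C ^ (p - 1) * (poleWeight (-(s * (p - 1) - p * γ)) x *
        circleMean y (fun R => poleWeight (s * (p - 1) - p * γ) R * h R ^ p) x) := by
  have hp0 : 0 ≤ p := by linarith
  have hmR : Measurable fun φ : ℝ => shiftR y x (Real.cos φ) := by unfold shiftR; fun_prop
  have e1 : circleMean y (fun R => poleWeight (-γ) R * h R) x =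
      circleMean y (fun R => poleWeight (-s) R * (poleWeight (s - γ) R * h R)) x := by
    refine setLIntegral_congr_fun measurableSet_Ioo fun φ hφ => ?_
    change poleWeight _ _ * _ = poleWeight _ _ * (poleWeight _ _ * _)
    rw [← mul_assoc, poleWeight_mul (shiftR_mem_Ioo hx hy hφ)]
    congr 2; ring
  have e2 : circleMean y (fun R => poleWeight (-s) R * (poleWeight (s - γ) R * h R) ^ p) x =
      circleMean y (fun R => poleWeight (s * (p - 1) - p * γ) R * h R ^ p) x := by
    refine setLIntegral_congr_fun measurableSet_Ioo fun φ hφ => ?_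
    have hR := shiftR_mem_Ioo hx hy hφ
    change poleWeight _ _ * (poleWeight _ _ * _) ^ p = poleWeight _ _ * _
    rw [ENNReal.mul_rpow_of_nonneg _ _ hp0, poleWeight_rpow hR _ hp0, ← mul_assoc,
      poleWeight_mul hR]
    congr 2; ring
  rw [ENNReal.mul_rpow_of_nonneg _ _ hp0, e1]
  have hJ : circleMean y (fun R => poleWeight (-s) R * (poleWeight (s - γ) R * h R)) x ^ p ≤
      circleMean y (poleWeight (-s)) x ^ (p - 1) *
      circleMean y (fun R => poleWeight (-s) R * (poleWeight (s - γ) R * h R) ^ p) x :=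
    lintegral_mul_rpow_le _ hp ((measurable_poleWeight _).comp hmR).aemeasurable
      (((measurable_poleWeight _).mul hh).comp hmR).aemeasurable
  rw [e2] at hJ
  calc poleWeight γ x ^ p * _
      ≤ poleWeight γ x ^ p * ((C * poleWeight (-s) x) ^ (p - 1) *
        circleMean y (fun R => poleWeight (s * (p - 1) - p * γ) R * h R ^ p) x) := by
        have : (0 : ℝ) ≤ p - 1 := by linarith
        gcongr
        exact hJ.trans (by gcongr)
    _ = _ := by
        rw [ENNReal.mul_rpow_of_nonneg _ _ (by linarith), poleWeight_rpow hx _ hp0,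
          poleWeight_rpow hx _ (by linarith)]
        have : poleWeight (-(s * (p - 1) - p * γ)) x =
            poleWeight (γ * p) x * poleWeight (-s * (p - 1)) x := by
          rw [poleWeight_mul hx]; congr 1; ring
        rw [this]
        ring

/-- The exponents of the weight for which the circle means are bounded: for `1 ≤ p < ∞` the
range is `-1/(2p) < γ < (1 - 1/p)/2`, for `p = ∞` it is `0 ≤ γ < 1/2`. -/
theorem exists_eLpNorm_circleMean_le {p : ℝ≥0∞} (hp : 1 ≤ p) {γ : ℝ}
    (hγ : p ≠ ∞ → -(1 / (2 * p.toReal)) < γ ∧ γ < 1 / 2 - 1 / (2 * p.toReal))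
    (hγ_top : p = ∞ → 0 ≤ γ ∧ γ < 1 / 2) :
    ∃ K : ℝ≥0∞, K ≠ ∞ ∧ ∀ y ∈ Icc (-1 : ℝ) 1, ∀ h : ℝ → ℝ≥0∞, Measurable h →
      eLpNorm (fun x => poleWeight γ x * circleMean y (fun R => poleWeight (-γ) R * h R) x)
        p segMeasure ≤ K * eLpNorm h p segMeasure := by
  by_cases hpt : p = ∞
  · obtain ⟨h0, h1⟩ := hγ_top hpt
    obtain ⟨C, hC, hCb⟩ := exists_circleMean_poleWeight_le h0 h1
    refine ⟨C, hC, fun y hy h hh => ?_⟩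
    rw [hpt, eLpNorm_exponent_top, eLpNorm_exponent_top]
    refine essSup_le_of_ae_le _ ?_
    have hae : ∀ᵐ x ∂segMeasure, h x ≤ eLpNormEssSup h segMeasure :=
      ae_le_eLpNormEssSup (f := h)
    filter_upwards [ae_ae_shiftR hy hae, ae_segMeasure_mem_Ioo] with x hx hxI
    rw [enorm_eq_self]
    set A := eLpNormEssSup h segMeasure
    have hmR : Measurable fun φ : ℝ => shiftR y x (Real.cos φ) := by unfold shiftR; fun_prop
    calc poleWeight γ x * circleMean y (fun R => poleWeight (-γ) R * h R) x
        ≤ poleWeight γ x * (circleMean y (poleWeight (-γ)) x * A) := by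
          gcongr
          unfold circleMean
          have hmw : Measurable fun φ => poleWeight (-γ) (shiftR y x (Real.cos φ)) :=
            (measurable_poleWeight _).comp hmR
          rw [← lintegral_mul_const _ hmw]
          refine lintegral_mono_ae ?_
          filter_upwards [hx] with φ hφ
          gcongr
      _ ≤ poleWeight γ x * ((C * poleWeight (-γ) x) * A) := by
          gcongr; exact hCb y hy x hxI
      _ = (poleWeight γ x * poleWeight (-γ) x) * (C * A) := by ring
      _ = C * A := by rw [poleWeight_mul hxI]; simp [poleWeight_zero]
  · obtain ⟨h0, h1⟩ := hγ hpt
    have hp0 : p ≠ 0 := (zero_lt_one.trans_le hp).ne'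
    have hp1 : 1 ≤ p.toReal := by
      rw [← ENNReal.toReal_one]; exact ENNReal.toReal_mono hpt hp
    set P := p.toReal with hP
    have hP0 : 0 < P := by linarith
    -- Weight exponents `s` for the inner mean and `s (p - 1) - p γ` for the dual one must both
    -- lie in `[0, 1/2)`.
    obtain ⟨s, hs0, hs1, he0, he1⟩ : ∃ s : ℝ, 0 ≤ s ∧ s < 1 / 2 ∧ 0 ≤ s * (P - 1) - P * γ ∧
        s * (P - 1) - P * γ < 1 / 2 := by
      have h0' : -(1 / 2) < P * γ := by
        have := mul_lt_mul_of_pos_left h0 hP0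
        have e : P * -(1 / (2 * P)) = -(1 / 2) := by field_simp
        linarith
      have h1' : P * γ < (P - 1) / 2 := by
        have := mul_lt_mul_of_pos_left h1 hP0
        have e : P * (1 / 2 - 1 / (2 * P)) = (P - 1) / 2 := by field_simp
        linarith
      rcases le_or_gt γ 0 with hg | hg
      · refine ⟨0, le_rfl, by norm_num, ?_, ?_⟩ <;> nlinarith
      · have hPγ := mul_pos hP0 hg
        have hP1 : 0 < P - 1 := by linarith
        refine ⟨P * γ / (P - 1), by positivity, ?_, ?_, ?_⟩
        · rw [div_lt_iff₀ hP1]; linarith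
        · rw [div_mul_cancel₀ _ hP1.ne']; simp
        · rw [div_mul_cancel₀ _ hP1.ne']; norm_num
    set e := s * (P - 1) - P * γ with he
    obtain ⟨C, hC, hCb⟩ := exists_circleMean_poleWeight_le hs0 hs1
    obtain ⟨D, hD, hDb⟩ := exists_circleMean_poleWeight_le he0 he1
    have hP1 : 0 ≤ P - 1 := by linarith
    have hCP : C ^ (P - 1) ≠ ∞ := ENNReal.rpow_ne_top_of_nonneg hP1 hC
    refine ⟨(C ^ (P - 1) * D) ^ (1 / P), ENNReal.rpow_ne_top_of_nonneg (by positivity)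
      (ENNReal.mul_ne_top hCP hD), fun y hy h hh => ?_⟩
    rw [eLpNorm_eq_lintegral_rpow_enorm_toReal hp0 hpt,
      eLpNorm_eq_lintegral_rpow_enorm_toReal hp0 hpt, ← hP,
      ← ENNReal.mul_rpow_of_nonneg _ _ (by positivity)]
    refine ENNReal.rpow_le_rpow ?_ (by positivity)
    simp only [enorm_eq_self]
    rw [segMeasure_eq_restrict_Ioo]
    have hm1 : Measurable fun R => poleWeight e R * h R ^ P :=
      (measurable_poleWeight e).mul (hh.pow_const _)
    calc ∫⁻ x in Ioo (-1 : ℝ) 1,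
          (poleWeight γ x * circleMean y (fun R => poleWeight (-γ) R * h R) x) ^ P
        ≤ ∫⁻ x in Ioo (-1 : ℝ) 1, C ^ (P - 1) * (poleWeight (-e) x *
            circleMean y (fun R => poleWeight e R * h R ^ P) x) :=
          setLIntegral_mono' measurableSet_Ioo fun x hx =>
            poleWeight_mul_circleMean_rpow_le hp1 hx hy (hCb y hy x hx) hh
      _ = C ^ (P - 1) * ∫⁻ x in Ioo (-1 : ℝ) 1, (poleWeight e x * h x ^ P) *
            circleMean y (poleWeight (-e)) x := by
          rw [lintegral_const_mul' _ _ hCP, lintegral_mul_circleMean_comm hy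
            (measurable_poleWeight _) hm1]
      _ ≤ C ^ (P - 1) * ∫⁻ x in Ioo (-1 : ℝ) 1, D * h x ^ P := by
          refine mul_le_mul' le_rfl (setLIntegral_mono' measurableSet_Ioo fun x hx => ?_)
          calc poleWeight e x * h x ^ P * circleMean y (poleWeight (-e)) x
              ≤ poleWeight e x * h x ^ P * (D * poleWeight (-e) x) := by
                gcongr; exact hDb y hy x hx
            _ = (poleWeight e x * poleWeight (-e) x) * (D * h x ^ P) := by ring
            _ = D * h x ^ P := by rw [poleWeight_mul hx]; simp [poleWeight_zero]
      _ = C ^ (P - 1) * D * ∫⁻ x in Ioo (-1 : ℝ) 1, h x ^ P := by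
          rw [lintegral_const_mul' _ _ hD, mul_assoc]

/-! ### The weighted spaces -/

theorem measurable_one_sub_sq_rpow (α : ℝ) : Measurable fun x : ℝ => (1 - x ^ 2) ^ α := by
  fun_prop

theorem memLpWeighted_iff {p : ℝ≥0∞} {α : ℝ} {f : ℝ → ℝ} :
    MemLpWeighted p α f ↔ AEStronglyMeasurable f segMeasure ∧ weightedNorm p α f < ∞ := by
  have hm := measurable_one_sub_sq_rpow α
  refine ⟨fun h => ⟨?_, h.2⟩, fun h => ⟨h.1.mul hm.aestronglyMeasurable, h.2⟩⟩
  refine (h.1.mul hm.inv.aestronglyMeasurable).congr ?_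
  filter_upwards [ae_segMeasure_mem_Ioo] with x hx
  have hx2 : 0 < 1 - x ^ 2 := by nlinarith [hx.1, hx.2]
  have : (1 - x ^ 2) ^ α ≠ 0 := (Real.rpow_pos_of_pos hx2 α).ne'
  simp only [Pi.mul_apply, Pi.inv_apply]
  field_simp

theorem weightedNorm_congr_ae {p : ℝ≥0∞} {α : ℝ} {f g : ℝ → ℝ} (h : f =ᵐ[segMeasure] g) :
    weightedNorm p α f = weightedNorm p α g :=
  eLpNorm_congr_ae (h.mono fun x hx => by simp only [hx])

theorem weightedNorm_add_le {p : ℝ≥0∞} (hp : 1 ≤ p) {α : ℝ} {f g : ℝ → ℝ}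
    (hf : MemLpWeighted p α f) (hg : MemLpWeighted p α g) :
    weightedNorm p α (fun x => f x + g x) ≤ weightedNorm p α f + weightedNorm p α g := by
  unfold weightedNorm
  simp only [add_mul]
  exact eLpNorm_add_le hf.1 hg.1 hp

theorem weightedNorm_const_mul (p : ℝ≥0∞) (α c : ℝ) (f : ℝ → ℝ) :
    weightedNorm p α (fun x => c * f x) = ‖c‖ₑ * weightedNorm p α f := by
  unfold weightedNorm
  simp only [mul_assoc]
  exact eLpNorm_const_smul c (fun x => f x * (1 - x ^ 2) ^ α) p segMeasure

namespace MemLpWeighted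

variable {p : ℝ≥0∞} {α : ℝ} {f g : ℝ → ℝ}

theorem weightedNorm_lt_top (hf : MemLpWeighted p α f) : weightedNorm p α f < ∞ := hf.2

theorem aestronglyMeasurable (hf : MemLpWeighted p α f) : AEStronglyMeasurable f segMeasure :=
  (memLpWeighted_iff.1 hf).1

theorem congr_ae (hf : MemLpWeighted p α f) (h : f =ᵐ[segMeasure] g) : MemLpWeighted p α g :=
  MemLp.ae_eq (h.mono fun x hx => by simp only [hx]) hf

theorem add (hf : MemLpWeighted p α f) (hg : MemLpWeighted p α g) :
    MemLpWeighted p α (fun x => f x + g x) := by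
  unfold MemLpWeighted
  simp only [add_mul]
  exact MemLp.add hf hg

theorem sub (hf : MemLpWeighted p α f) (hg : MemLpWeighted p α g) :
    MemLpWeighted p α (fun x => f x - g x) := by
  unfold MemLpWeighted
  simp only [sub_mul]
  exact MemLp.sub hf hg

theorem const_mul (hf : MemLpWeighted p α f) (c : ℝ) : MemLpWeighted p α (fun x => c * f x) := by
  unfold MemLpWeighted
  simp only [mul_assoc]
  exact MemLp.const_mul hf c

end MemLpWeighted

theorem weightedNorm_sub_le {p : ℝ≥0∞} (hp : 1 ≤ p) {α : ℝ} {f g : ℝ → ℝ}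
    (hf : MemLpWeighted p α f) (hg : MemLpWeighted p α g) :
    weightedNorm p α (fun x => f x - g x) ≤ weightedNorm p α f + weightedNorm p α g := by
  unfold weightedNorm
  simp only [sub_mul]
  exact eLpNorm_sub_le hf.1 hg.1 hp

/-! ### Boundedness of the shift -/

/-- The conditions on `p` and `α` under which the shift is bounded on `L_{p,α}`. -/
def AdmissibleExponents (p : ℝ≥0∞) (α : ℝ) : Prop :=
  1 ≤ p ∧ (p ≠ ∞ → 1 - 1 / (2 * p.toReal) < α ∧ α < 3 / 2 - 1 / (2 * p.toReal)) ∧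
    (p = ∞ → 1 ≤ α ∧ α < 3 / 2)

theorem ae_lt_top_of_eLpNorm_lt_top {p : ℝ≥0∞} (hp : 1 ≤ p) {g : ℝ → ℝ≥0∞} (hg : Measurable g)
    (h : eLpNorm g p segMeasure < ∞) : ∀ᵐ x ∂segMeasure, g x < ∞ := by
  have h1 : eLpNorm g 1 segMeasure < ∞ :=
    (eLpNorm_le_eLpNorm_mul_rpow_measure_univ hp hg.aestronglyMeasurable).trans_lt
      (ENNReal.mul_lt_top h (ENNReal.rpow_lt_top_of_nonneg (by
        have : (1 : ℝ≥0∞).toReal = 1 := by simp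
        rw [this, sub_nonneg]
        rcases eq_or_ne p ∞ with rfl | hpt
        · simp
        · have h1 : 1 ≤ p.toReal := by
            rw [← ENNReal.toReal_one]; exact ENNReal.toReal_mono hpt hp
          rw [div_one]
          exact (div_le_one (by linarith)).2 h1) (measure_ne_top _ _)))
  rw [eLpNorm_one_eq_lintegral_enorm] at h1
  simp only [enorm_eq_self] at h1
  exact ae_lt_top hg h1.ne

/-- The shift is bounded on `L_{p,α}` uniformly in `y ∈ [-1, 1]`; in particular the defining
integral exists for almost every `x`. -/
theorem exists_weightedNorm_asymShift_le {p : ℝ≥0∞} {α : ℝ} (h : AdmissibleExponents p α) :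
    ∃ K : ℝ≥0∞, K ≠ ∞ ∧ ∀ y ∈ Icc (-1 : ℝ) 1, ∀ f : ℝ → ℝ, MemLpWeighted p α f →
      weightedNorm p α (asymShift y f) ≤ K * weightedNorm p α f ∧
      ∀ᵐ x ∂segMeasure, IntervalIntegrable (fun φ =>
        shiftB y x (Real.cos φ) (shiftR y x (Real.cos φ)) * f (shiftR y x (Real.cos φ)))
        volume 0 Real.pi := by
  obtain ⟨hp, hα, hα_top⟩ := h
  obtain ⟨K, hK, hKb⟩ := exists_eLpNorm_circleMean_le hp (γ := α - 1)
    (fun hpt => ⟨by linarith [(hα hpt).1], by linarith [(hα hpt).2]⟩)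
    (fun hpt => ⟨by linarith [(hα_top hpt).1], by linarith [(hα_top hpt).2]⟩)
  refine ⟨K, hK, fun y hy f hf => ?_⟩
  -- Pass to a Borel measurable representative.
  set g := hf.aestronglyMeasurable.mk f with hgdef
  have hfg : f =ᵐ[segMeasure] g := hf.aestronglyMeasurable.ae_eq_mk
  have hgm : Measurable g := hf.aestronglyMeasurable.stronglyMeasurable_mk.measurable
  have hg : MemLpWeighted p α g := hf.congr_ae hfg
  set h : ℝ → ℝ≥0∞ := fun R => ‖g R * (1 - R ^ 2) ^ α‖ₑ with hh
  have hhm : Measurable h := (hgm.mul (measurable_one_sub_sq_rpow α)).enorm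
  have hh_norm : eLpNorm h p segMeasure = weightedNorm p α g :=
    eLpNorm_enorm (fun x => g x * (1 - x ^ 2) ^ α)
  have hb := hKb y hy h hhm
  rw [hh_norm] at hb
  constructor
  · rw [weightedNorm_congr_ae (asymShift_congr_ae hy hfg), weightedNorm_congr_ae hfg]
    refine le_trans (eLpNorm_mono_enorm_ae ?_) hb
    filter_upwards [ae_segMeasure_mem_Ioo] with x hx
    rw [enorm_eq_self]
    exact enorm_asymShift_mul_le hx hy α g
  · have hmm : Measurable fun R => poleWeight (-(α - 1)) R * h R :=
      (measurable_poleWeight _).mul hhm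
    have hfin := ae_lt_top_of_eLpNorm_lt_top hp
      ((measurable_poleWeight (α - 1)).mul (measurable_circleMean y hmm))
      (hb.trans_lt (ENNReal.mul_lt_top hK.lt_top hg.weightedNorm_lt_top))
    filter_upwards [hfin, ae_ae_shiftR hy hfg, ae_segMeasure_mem_Ioo] with x hx hfgx hxI
    have hx2 : 0 < 1 - x ^ 2 := by nlinarith [hxI.1, hxI.2]
    have hw : poleWeight (α - 1) x ≠ 0 := by
      unfold poleWeight
      exact (ENNReal.ofReal_pos.2 (by positivity)).ne'
    have hx' : circleMean y (fun R => poleWeight (-(α - 1)) R * h R) x < ∞ :=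
      ENNReal.lt_top_of_mul_ne_top_right hx.ne hw
    rw [intervalIntegrable_iff_integrableOn_Ioo_of_le Real.pi_pos.le]
    have hmR : Measurable fun φ : ℝ => shiftR y x (Real.cos φ) := by unfold shiftR; fun_prop
    have hmB : Measurable fun φ : ℝ => shiftB y x (Real.cos φ) (shiftR y x (Real.cos φ)) := by
      unfold shiftB shiftR; fun_prop
    have hgi : IntegrableOn (fun φ => shiftB y x (Real.cos φ) (shiftR y x (Real.cos φ)) *
        g (shiftR y x (Real.cos φ))) (Ioo 0 Real.pi) := by
      refine ⟨(hmB.mul (hgm.comp hmR)).aestronglyMeasurable, lt_of_le_of_lt ?_ hx'⟩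
      exact setLIntegral_mono' measurableSet_Ioo fun φ hφ => enorm_shiftB_mul_le hxI hy hφ α g
    refine hgi.congr ?_
    filter_upwards [hfgx] with φ hφ
    rw [hφ]

theorem MemLpWeighted.asymShift {p : ℝ≥0∞} {α : ℝ} (h : AdmissibleExponents p α) {y : ℝ}
    (hy : y ∈ Icc (-1 : ℝ) 1) {f : ℝ → ℝ} (hf : MemLpWeighted p α f) :
    MemLpWeighted p α (asymShift y f) := by
  obtain ⟨K, hK, hKb⟩ := exists_weightedNorm_asymShift_le h
  exact memLpWeighted_iff.2 ⟨aestronglyMeasurable_asymShift hy hf.aestronglyMeasurable,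
    (hKb y hy f hf).1.trans_lt (ENNReal.mul_lt_top hK.lt_top hf.weightedNorm_lt_top)⟩

theorem asymShift_add_ae {p : ℝ≥0∞} {α : ℝ} (h : AdmissibleExponents p α) {y : ℝ}
    (hy : y ∈ Icc (-1 : ℝ) 1) {f g : ℝ → ℝ} (hf : MemLpWeighted p α f)
    (hg : MemLpWeighted p α g) :
    asymShift y (fun x => f x + g x) =ᵐ[segMeasure] fun x => asymShift y f x + asymShift y g x := by
  obtain ⟨K, hK, hKb⟩ := exists_weightedNorm_asymShift_le h
  filter_upwards [(hKb y hy f hf).2, (hKb y hy g hg).2] with x hfx hgx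
  unfold _root_.asymShift
  rw [← mul_add, ← intervalIntegral.integral_add hfx hgx]
  simp only [mul_add]

/-! ### Linearity of the generalised differences -/

theorem MemLpWeighted.genShift {p : ℝ≥0∞} {α : ℝ} (h : AdmissibleExponents p α) (t : ℝ)
    {f : ℝ → ℝ} (hf : MemLpWeighted p α f) : MemLpWeighted p α (genShift t f) := by
  have := (hf.asymShift h (y := Real.cos t) ⟨Real.neg_one_le_cos t, Real.cos_le_one t⟩).const_mul
    (Real.pi * Real.cos (t / 2) ^ 4)⁻¹
  convert this using 2 with x
  exact genShift_eq_asymShift t f x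

theorem genShift_congr_ae (t : ℝ) {f g : ℝ → ℝ} (h : f =ᵐ[segMeasure] g) :
    genShift t f =ᵐ[segMeasure] genShift t g := by
  filter_upwards [asymShift_congr_ae ⟨Real.neg_one_le_cos t, Real.cos_le_one t⟩ h] with x hx
  rw [genShift_eq_asymShift, genShift_eq_asymShift, hx]

theorem genShift_add_ae {p : ℝ≥0∞} {α : ℝ} (h : AdmissibleExponents p α) (t : ℝ) {f g : ℝ → ℝ}
    (hf : MemLpWeighted p α f) (hg : MemLpWeighted p α g) :
    genShift t (fun x => f x + g x) =ᵐ[segMeasure] fun x => genShift t f x + genShift t g x := by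
  filter_upwards [asymShift_add_ae h ⟨Real.neg_one_le_cos t, Real.cos_le_one t⟩ hf hg] with x hx
  rw [genShift_eq_asymShift, genShift_eq_asymShift, genShift_eq_asymShift, hx, mul_add]

theorem MemLpWeighted.genDiff {p : ℝ≥0∞} {α : ℝ} (h : AdmissibleExponents p α) {f : ℝ → ℝ}
    (hf : MemLpWeighted p α f) : ∀ (r : ℕ) (t : Fin r → ℝ), MemLpWeighted p α (genDiff r t f)
  | 0, _ => hf
  | r + 1, _ => ((hf.genDiff h r _).genShift h _).sub (hf.genDiff h r _)

theorem genDiff_congr_ae {f g : ℝ → ℝ} (h : f =ᵐ[segMeasure] g) :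
    ∀ (r : ℕ) (t : Fin r → ℝ), genDiff r t f =ᵐ[segMeasure] genDiff r t g
  | 0, _ => h
  | r + 1, t => by
    filter_upwards [genDiff_congr_ae h r fun j => t j.castSucc,
      genShift_congr_ae (t (Fin.last r)) (genDiff_congr_ae h r fun j => t j.castSucc)] with x h1 h2
    simp only [genDiff, h1, h2]

theorem genDiff_add_ae {p : ℝ≥0∞} {α : ℝ} (h : AdmissibleExponents p α) {f g : ℝ → ℝ}
    (hf : MemLpWeighted p α f) (hg : MemLpWeighted p α g) :
    ∀ (r : ℕ) (t : Fin r → ℝ), genDiff r t (fun x => f x + g x) =ᵐ[segMeasure]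
      fun x => genDiff r t f x + genDiff r t g x
  | 0, _ => Filter.EventuallyEq.rfl
  | r + 1, t => by
    have ih := genDiff_add_ae h hf hg r fun j => t j.castSucc
    filter_upwards [ih, genShift_congr_ae (t (Fin.last r)) ih,
      genShift_add_ae h (t (Fin.last r)) (hf.genDiff h r fun j => t j.castSucc)
        (hg.genDiff h r fun j => t j.castSucc)] with x h1 h2 h3
    simp only [genDiff, h1, h2, h3]
    ring

theorem weightedNorm_genDiff_add_le {p : ℝ≥0∞} {α : ℝ} (h : AdmissibleExponents p α)
    {f g : ℝ → ℝ} (hf : MemLpWeighted p α f) (hg : MemLpWeighted p α g) (r : ℕ)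
    (t : Fin r → ℝ) :
    weightedNorm p α (genDiff r t fun x => f x + g x) ≤
      weightedNorm p α (genDiff r t f) + weightedNorm p α (genDiff r t g) := by
  rw [weightedNorm_congr_ae (genDiff_add_ae h hf hg r t)]
  exact weightedNorm_add_le h.1 (hf.genDiff h r t) (hg.genDiff h r t)

/-! ### Shifts of polynomials -/

/-- Polynomial functions of `x`, `u = √(1 - x²)` and `z`, of degree at most `m` in `(x, u)`, that
are invariant under `(u, z) ↦ (-u, -z)`. Reducing by `u² = 1 - x²` they have the form
`a(z², x) + u z b(z², x)`, where the outer variable of `a` and `b` is `x`. -/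
def IsEvenForm (m : ℕ) (F : ℝ → ℝ → ℝ) : Prop :=
  ∃ a b : Polynomial (Polynomial ℝ), a.degree ≤ m ∧ b.degree + 1 ≤ m ∧
    ∀ x ∈ Icc (-1 : ℝ) 1, ∀ z : ℝ,
      F x z = a.evalEval (z ^ 2) x + √(1 - x ^ 2) * z * b.evalEval (z ^ 2) x

namespace IsEvenForm

open Polynomial

variable {m k : ℕ} {F G : ℝ → ℝ → ℝ}

theorem mono (hF : IsEvenForm m F) (h : m ≤ k) : IsEvenForm k F := by
  obtain ⟨a, b, ha, hb, hab⟩ := hF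
  have : (m : WithBot ℕ) ≤ k := by exact_mod_cast h
  exact ⟨a, b, ha.trans this, hb.trans this, hab⟩

theorem const (c : ℝ) : IsEvenForm 0 fun _ _ => c :=
  ⟨C (C c), 0, degree_C_le, by simp, fun x _ z => by simp⟩

theorem add (hF : IsEvenForm m F) (hG : IsEvenForm m G) :
    IsEvenForm m fun x z => F x z + G x z := by
  obtain ⟨a, b, ha, hb, hab⟩ := hF
  obtain ⟨c, d, hc, hd, hcd⟩ := hG
  refine ⟨a + c, b + d, (degree_add_le a c).trans (max_le ha hc), ?_, fun x hx z => ?_⟩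
  · calc (b + d).degree + 1 ≤ max b.degree d.degree + 1 := by gcongr; exact degree_add_le b d
      _ ≤ m := by rcases max_cases b.degree d.degree with h | h <;> rw [h.1] <;> assumption
  · simp only [hab x hx z, hcd x hx z, evalEval_add]; ring

theorem mul (hF : IsEvenForm m F) (hG : IsEvenForm k G) :
    IsEvenForm (m + k) fun x z => F x z * G x z := by
  obtain ⟨a, b, ha, hb, hab⟩ := hF
  obtain ⟨c, d, hc, hd, hcd⟩ := hG
  have ha' : a.degree + d.degree + 1 ≤ (m + k : ℕ) := by
    rw [add_assoc]; push_cast; exact add_le_add ha hd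
  have hb' : b.degree + c.degree + 1 ≤ (m + k : ℕ) := by
    rw [add_right_comm]; push_cast; exact add_le_add hb hc
  have hbd : (2 : WithBot ℕ) + (b.degree + d.degree) ≤ (m + k : ℕ) := by
    have : (2 : WithBot ℕ) + (b.degree + d.degree) = (b.degree + 1) + (d.degree + 1) := by
      rw [← one_add_one_eq_two]; ac_rfl
    rw [this]; push_cast; exact add_le_add hb hd
  have h2 : ((1 - X ^ 2) * C X : Polynomial (Polynomial ℝ)).degree ≤ 2 := by compute_degree
  refine ⟨a * c + (1 - X ^ 2) * C X * (b * d), a * d + b * c, ?_, ?_, fun x hx z => ?_⟩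
  · refine (degree_add_le _ _).trans (max_le ?_ ?_)
    · exact (degree_mul_le _ _).trans (by push_cast; exact add_le_add ha hc)
    · exact (degree_mul_le _ _).trans ((add_le_add h2 (degree_mul_le _ _)).trans hbd)
  · calc (a * d + b * c).degree + 1
        ≤ max (a.degree + d.degree) (b.degree + c.degree) + 1 := by
          gcongr
          exact (degree_add_le _ _).trans (max_le_max (degree_mul_le _ _) (degree_mul_le _ _))
      _ ≤ (m + k : ℕ) := by
          rcases max_cases (a.degree + d.degree) (b.degree + c.degree) with h | h <;>
            rw [h.1] <;> assumption
  · have hu : √(1 - x ^ 2) ^ 2 = 1 - x ^ 2 := Real.sq_sqrt (by nlinarith [hx.1, hx.2])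
    simp only [hab x hx z, hcd x hx z, evalEval_add, evalEval_mul, evalEval_sub, evalEval_pow,
      evalEval_X, evalEval_C, evalEval_one, eval_X]
    linear_combination (z ^ 2 * b.evalEval (z ^ 2) x * d.evalEval (z ^ 2) x) * hu

theorem const_mul (hF : IsEvenForm m F) (c : ℝ) : IsEvenForm m fun x z => c * F x z := by
  simpa using (const c).mul hF

theorem pow (hF : IsEvenForm m F) : ∀ j : ℕ, IsEvenForm (m * j) fun x z => F x z ^ j
  | 0 => by simpa using const 1
  | j + 1 => by simpa only [pow_succ, Nat.mul_succ] using (hF.pow j).mul hF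

theorem sum {ι : Type*} (s : Finset ι) {F : ι → ℝ → ℝ → ℝ}
    (hF : ∀ i ∈ s, IsEvenForm m (F i)) : IsEvenForm m fun x z => ∑ i ∈ s, F i x z := by
  classical
  induction s using Finset.induction_on with
  | empty => simpa using (const 0).mono (Nat.zero_le m)
  | insert i s hi ih =>
    simp only [Finset.sum_insert hi]
    exact (hF i (Finset.mem_insert_self i s)).add
      (ih fun j hj => hF j (Finset.mem_insert_of_mem hj))

theorem polynomial_eval (hF : IsEvenForm 1 F) {Q : ℝ[X]} (hQ : Q.natDegree ≤ m) :
    IsEvenForm m fun x z => Q.eval (F x z) := by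
  simp only [eval_eq_sum_range' (Nat.lt_succ_of_le hQ)]
  refine sum _ fun i hi => ((hF.pow i).const_mul _).mono ?_
  rw [one_mul]
  exact Nat.lt_succ_iff.1 (Finset.mem_range.1 hi)

end IsEvenForm

open Polynomial in
theorem integral_cos_mul_eval_cos_sq (e : ℝ[X]) :
    ∫ φ in (0 : ℝ)..Real.pi, Real.cos φ * e.eval (Real.cos φ ^ 2) = 0 := by
  have h := intervalIntegral.integral_comp_sub_left (a := 0) (b := Real.pi)
    (fun φ => Real.cos φ * e.eval (Real.cos φ ^ 2)) Real.pi
  simp only [Real.cos_pi_sub, neg_sq, neg_mul, intervalIntegral.integral_neg, sub_self,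
    sub_zero] at h
  linarith

open Polynomial in
/-- Integration over `φ` kills the part that is odd in `z = cos φ`, and with it the square root. -/
theorem IsEvenForm.exists_integral_eq_eval {m : ℕ} {F : ℝ → ℝ → ℝ} (hF : IsEvenForm m F) :
    ∃ q : ℝ[X], q.natDegree ≤ m ∧ ∀ x ∈ Icc (-1 : ℝ) 1,
      ∫ φ in (0 : ℝ)..Real.pi, F x (Real.cos φ) = q.eval x := by
  obtain ⟨a, b, ha, hb, hab⟩ := hF
  have ha' : a.natDegree < m + 1 := Nat.lt_succ_of_le (natDegree_le_of_degree_le ha)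
  have hcont : ∀ e : ℝ[X], Continuous fun φ : ℝ => e.eval (Real.cos φ ^ 2) := fun e =>
    e.continuous.comp (Real.continuous_cos.pow 2)
  have hexp : ∀ (c : Polynomial ℝ[X]) (N : ℕ), c.natDegree < N → ∀ x z : ℝ,
      c.evalEval (z ^ 2) x = ∑ i ∈ Finset.range N, (c.coeff i).eval (z ^ 2) * x ^ i :=
    fun c N hN x z => by
      rw [evalEval, eval_eq_sum_range' hN, eval_finsetSum]
      simp
  refine ⟨∑ i ∈ Finset.range (m + 1),
    C (∫ φ in (0 : ℝ)..Real.pi, (a.coeff i).eval (Real.cos φ ^ 2)) * X ^ i, ?_, fun x hx => ?_⟩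
  · refine natDegree_sum_le_of_forall_le _ _ fun i hi => ?_
    exact (natDegree_C_mul_X_pow_le _ _).trans (Nat.lt_succ_iff.1 (Finset.mem_range.1 hi))
  have hbx : ∫ φ in (0 : ℝ)..Real.pi,
      √(1 - x ^ 2) * Real.cos φ * b.evalEval (Real.cos φ ^ 2) x = 0 := by
    have e1 : ∀ φ : ℝ, √(1 - x ^ 2) * Real.cos φ * b.evalEval (Real.cos φ ^ 2) x =
        ∑ i ∈ Finset.range (b.natDegree + 1), √(1 - x ^ 2) * x ^ i *
          (Real.cos φ * (b.coeff i).eval (Real.cos φ ^ 2)) := fun φ => by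
      rw [hexp b _ (Nat.lt_succ_self _), Finset.mul_sum]
      exact Finset.sum_congr rfl fun i _ => by ring
    have hi : ∀ i ∈ Finset.range (b.natDegree + 1), IntervalIntegrable (fun φ => √(1 - x ^ 2) *
        x ^ i * (Real.cos φ * (b.coeff i).eval (Real.cos φ ^ 2))) volume 0 Real.pi := fun i _ =>
      (continuous_const.mul (Real.continuous_cos.mul (hcont _))).intervalIntegrable _ _
    simp only [e1]
    rw [intervalIntegral.integral_finsetSum hi]
    simp only [intervalIntegral.integral_const_mul, integral_cos_mul_eval_cos_sq, mul_zero,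
      Finset.sum_const_zero]
  have hca : Continuous fun φ : ℝ => a.evalEval (Real.cos φ ^ 2) x := by
    simp only [evalEval]; exact hcont _
  have hcb : Continuous fun φ : ℝ => √(1 - x ^ 2) * Real.cos φ * b.evalEval (Real.cos φ ^ 2) x := by
    simp only [evalEval]; exact (continuous_const.mul Real.continuous_cos).mul (hcont _)
  simp only [hab x hx]
  rw [intervalIntegral.integral_add (hca.intervalIntegrable _ _) (hcb.intervalIntegrable _ _), hbx,
    add_zero, eval_finsetSum]
  have hi : ∀ i ∈ Finset.range (m + 1), IntervalIntegrable (fun φ =>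
      (a.coeff i).eval (Real.cos φ ^ 2) * x ^ i) volume 0 Real.pi := fun i _ =>
    ((hcont _).mul continuous_const).intervalIntegrable _ _
  simp only [hexp a _ ha']
  rw [intervalIntegral.integral_finsetSum hi]
  exact Finset.sum_congr rfl fun i _ => by simp

theorem shiftR_comm (y x z : ℝ) : shiftR y x z = shiftR x y z := by
  unfold shiftR; ring

open Polynomial in
theorem isEvenForm_shiftR (y : ℝ) : IsEvenForm 1 fun x z => shiftR y x z := by
  refine ⟨C (C y) * X, -C (C √(1 - y ^ 2)), ?_, ?_, fun x _ z => ?_⟩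
  · compute_degree; norm_num
  · rw [degree_neg]
    exact (add_le_add_left degree_C_le 1).trans (by simp)
  · simp [shiftR]; ring

open Polynomial in
theorem isEvenForm_shiftB_left (y : ℝ) :
    IsEvenForm 2 fun x z => shiftB y x z (shiftR y x z) := by
  have hL : IsEvenForm 2 fun x z =>
      (√(1 - x ^ 2) * y + x * z * √(1 - y ^ 2) + √(1 - x ^ 2) * (1 - y) * (1 - z ^ 2)) ^ 2 := by
    set e : ℝ[X] := C y + C (1 - y) * (1 - X) with he
    refine ⟨C (e ^ 2) * (1 - X ^ 2) + C (C (√(1 - y ^ 2) ^ 2) * X) * X ^ 2,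
      C (C (2 * √(1 - y ^ 2)) * e) * X, ?_, ?_, fun x hx z => ?_⟩
    · compute_degree; norm_num
    · calc (C (C (2 * √(1 - y ^ 2)) * e) * X : Polynomial ℝ[X]).degree + 1 ≤ 1 + 1 := by
            gcongr; exact degree_C_mul_X_le _
        _ ≤ ((2 : ℕ) : WithBot ℕ) := by norm_num
    · have hu : √(1 - x ^ 2) ^ 2 = 1 - x ^ 2 := Real.sq_sqrt (by nlinarith [hx.1, hx.2])
      simp only [he, evalEval_add, evalEval_mul, evalEval_sub, evalEval_pow,
        evalEval_X, evalEval_C, evalEval_one, eval_X, eval_add, eval_sub, eval_mul, eval_pow,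
        eval_C, eval_one]
      linear_combination ((y + (1 - y) * (1 - z ^ 2)) ^ 2) * hu
  have h := ((hL.const_mul 2).add ((IsEvenForm.const (-1)).mono (Nat.zero_le 2))).add
    ((isEvenForm_shiftR y).pow 2)
  convert h using 3 with x z
  unfold shiftB; ring

open Polynomial in
theorem isEvenForm_shiftB_right (x : ℝ) :
    IsEvenForm 2 fun y z => shiftB y x z (shiftR y x z) := by
  have hL : IsEvenForm 1 fun y z =>
      √(1 - x ^ 2) * y + x * z * √(1 - y ^ 2) + √(1 - x ^ 2) * (1 - y) * (1 - z ^ 2) := by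
    refine ⟨C (C √(1 - x ^ 2)) * (X + (1 - X) * C (1 - X)), C (C x), ?_, ?_, fun y _ z => ?_⟩
    · compute_degree; norm_num
    · exact (add_le_add_left degree_C_le 1).trans (by simp)
    · simp only [evalEval_add, evalEval_mul, evalEval_sub, evalEval_X, evalEval_C, evalEval_one,
        eval_X, eval_sub, eval_C, eval_one]
      ring
  have hR : IsEvenForm 1 fun y z => shiftR y x z := by
    simpa only [shiftR_comm] using isEvenForm_shiftR x
  have h := (((hL.pow 2).const_mul 2).add ((IsEvenForm.const (-1)).mono (Nat.zero_le 2))).add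
    (hR.pow 2)
  convert h using 3 with y z
  unfold shiftB; ring

open Polynomial in
/-- For fixed `x`, the shift of a polynomial of degree at most `N` is a polynomial of degree at
most `N + 2` in `y`. -/
theorem exists_asymShift_eq_eval_right {N : ℕ} {Q : ℝ[X]} (hQ : Q.natDegree ≤ N) (x : ℝ) :
    ∃ q : ℝ[X], q.natDegree ≤ N + 2 ∧ ∀ y ∈ Icc (-1 : ℝ) 1,
      asymShift y (fun s => Q.eval s) x = q.eval y := by
  have hR : IsEvenForm 1 fun y z => shiftR y x z := by
    simpa only [shiftR_comm] using isEvenForm_shiftR x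
  obtain ⟨q, hq, hqe⟩ :=
    ((isEvenForm_shiftB_right x).mul (hR.polynomial_eval hQ)).exists_integral_eq_eval
  refine ⟨C ((1 - x ^ 2)⁻¹) * q, ?_, fun y hy => ?_⟩
  · exact (natDegree_C_mul_le _ _).trans (by omega)
  · rw [eval_mul, eval_C, ← hqe y hy]; rfl

/-- At a pole `R` is constant along the circle and the kernel is a multiple of `cos 2φ`. -/
theorem integral_shiftB_pole {x y : ℝ} (hx : x ^ 2 = 1) (hy : y ∈ Icc (-1 : ℝ) 1) (f : ℝ → ℝ) :
    ∫ φ in (0 : ℝ)..Real.pi,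
      shiftB y x (Real.cos φ) (shiftR y x (Real.cos φ)) * f (shiftR y x (Real.cos φ)) = 0 := by
  have hw : √(1 - y ^ 2) ^ 2 = 1 - y ^ 2 := Real.sq_sqrt (by nlinarith [hy.1, hy.2])
  have e : ∀ φ : ℝ, shiftB y x (Real.cos φ) (shiftR y x (Real.cos φ)) *
      f (shiftR y x (Real.cos φ)) = (1 - y ^ 2) * f (x * y) * (2 * Real.cos φ ^ 2 - 1) :=
      fun φ => by
    have hR : shiftR y x (Real.cos φ) = x * y := by simp [shiftR, hx]
    rw [hR]
    have hB : shiftB y x (Real.cos φ) (x * y) = (1 - y ^ 2) * (2 * Real.cos φ ^ 2 - 1) := by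
      simp only [shiftB, hx, sub_self, Real.sqrt_zero, zero_mul, zero_add, add_zero]
      linear_combination (2 * Real.cos φ ^ 2 * √(1 - y ^ 2) ^ 2 + y ^ 2) * hx +
        2 * Real.cos φ ^ 2 * hw
    rw [hB]; ring
  simp only [e]
  rw [intervalIntegral.integral_const_mul, intervalIntegral.integral_sub
    (by apply Continuous.intervalIntegrable; fun_prop) (by simp),
    intervalIntegral.integral_const_mul, integral_cos_sq]
  simp only [Real.cos_pi, Real.sin_pi, Real.cos_zero, Real.sin_zero,
    intervalIntegral.integral_const, smul_eq_mul]
  ring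

open Polynomial in
/-- The shift of a polynomial in `x` is a polynomial of no larger degree: the integral is a
polynomial of degree `N + 2` vanishing at both poles, so the factor `1 - x²` can be divided out. -/
theorem exists_asymShift_eq_eval_left {N : ℕ} {Q : ℝ[X]} (hQ : Q.natDegree ≤ N) {y : ℝ}
    (hy : y ∈ Icc (-1 : ℝ) 1) :
    ∃ q : ℝ[X], q.natDegree ≤ N ∧ ∀ x ∈ Ioo (-1 : ℝ) 1,
      asymShift y (fun s => Q.eval s) x = q.eval x := by
  obtain ⟨q, hq, hqe⟩ := ((isEvenForm_shiftB_left y).mul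
    ((isEvenForm_shiftR y).polynomial_eval hQ)).exists_integral_eq_eval
  have h1 : q.IsRoot 1 := by
    rw [IsRoot, ← hqe 1 (by norm_num)]
    exact integral_shiftB_pole (by norm_num) hy fun s => Q.eval s
  have h2 : q.IsRoot (-1) := by
    rw [IsRoot, ← hqe (-1) (by norm_num)]
    exact integral_shiftB_pole (by norm_num) hy fun s => Q.eval s
  obtain ⟨q₁, rfl⟩ := dvd_iff_isRoot.2 h1
  have h3 : q₁.IsRoot (-1) := by
    rw [IsRoot, eval_mul, mul_eq_zero] at h2
    refine h2.resolve_left ?_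
    simp only [eval_sub, eval_X, eval_C]; norm_num
  obtain ⟨q₂, rfl⟩ := dvd_iff_isRoot.2 h3
  refine ⟨-q₂, ?_, fun x hx => ?_⟩
  · rw [natDegree_neg]
    rcases eq_or_ne q₂ 0 with rfl | h0
    · simp
    have hne : (X - C (-1) : ℝ[X]) * q₂ ≠ 0 := mul_ne_zero (X_sub_C_ne_zero _) h0
    rw [natDegree_mul (X_sub_C_ne_zero _) hne, natDegree_mul (X_sub_C_ne_zero _) h0,
      natDegree_X_sub_C, natDegree_X_sub_C] at hq
    omega
  · have hx2 : 1 - x ^ 2 ≠ 0 := by nlinarith [hx.1, hx.2]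
    have h := hqe x (Ioo_subset_Icc_self hx)
    unfold asymShift
    rw [h, inv_mul_eq_iff_eq_mul₀ hx2]
    simp only [eval_mul, eval_sub, eval_X, eval_C, eval_neg]
    ring

/-- The value on constants is what the factor `π cos⁴ (t / 2)` normalises. -/
theorem asymShift_const {x y : ℝ} (hx : x ∈ Ioo (-1 : ℝ) 1) (hy : y ∈ Icc (-1 : ℝ) 1) (c : ℝ) :
    asymShift y (fun _ => c) x = Real.pi * ((1 + y) / 2) ^ 2 * c := by
  have hx2 : 0 < 1 - x ^ 2 := by nlinarith [hx.1, hx.2]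
  have hu : √(1 - x ^ 2) ^ 2 = 1 - x ^ 2 := Real.sq_sqrt hx2.le
  have hw : √(1 - y ^ 2) ^ 2 = 1 - y ^ 2 := Real.sq_sqrt (by nlinarith [hy.1, hy.2])
  have hi1 : ∫ φ in (0 : ℝ)..Real.pi, Real.cos φ = 0 := by simp
  have hi2 : ∫ φ in (0 : ℝ)..Real.pi, Real.cos φ ^ 2 = Real.pi / 2 := by
    rw [integral_cos_sq]; simp
  have hi3 : ∫ φ in (0 : ℝ)..Real.pi, Real.cos φ ^ 3 = 0 := by
    have := integral_cos_mul_eval_cos_sq Polynomial.X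
    simp only [Polynomial.eval_X] at this
    rw [← this]; congr 1; ext φ; ring
  have hi4 : ∫ φ in (0 : ℝ)..Real.pi, Real.cos φ ^ 4 = 3 * Real.pi / 8 := by
    rw [integral_cos_pow (n := 2), hi2]; simp; ring
  unfold asymShift
  rw [inv_mul_eq_iff_eq_mul₀ hx2.ne', intervalIntegral.integral_mul_const]
  have e : ∀ φ : ℝ, shiftB y x (Real.cos φ) (shiftR y x (Real.cos φ)) =
      (2 * (1 - x ^ 2) - 1 + x ^ 2 * y ^ 2) +
      (4 - 2 * y) * (x * √(1 - x ^ 2) * √(1 - y ^ 2)) * Real.cos φ +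
      (2 * x ^ 2 * (1 - y ^ 2) - 4 * (1 - x ^ 2) * (1 - y) + (1 - x ^ 2) * (1 - y ^ 2)) *
        Real.cos φ ^ 2 +
      -(4 * (1 - y) * (x * √(1 - x ^ 2) * √(1 - y ^ 2))) * Real.cos φ ^ 3 +
      2 * (1 - x ^ 2) * (1 - y) ^ 2 * Real.cos φ ^ 4 := fun φ => by
    unfold shiftB shiftR
    generalize √(1 - x ^ 2) = u at *
    generalize √(1 - y ^ 2) = w at *
    generalize Real.cos φ = z
    linear_combination (2 * (1 - (1 - y) * z ^ 2) ^ 2 + w ^ 2 * z ^ 2) * hu +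
      (2 * x ^ 2 * z ^ 2 + (1 - x ^ 2) * z ^ 2) * hw
  simp only [e]
  have hc : ∀ (a : ℝ) (k : ℕ), IntervalIntegrable (fun φ : ℝ => a * Real.cos φ ^ k) volume 0
      Real.pi := fun a k => by apply Continuous.intervalIntegrable; fun_prop
  have hc1 : ∀ a : ℝ, IntervalIntegrable (fun φ : ℝ => a * Real.cos φ) volume 0
      Real.pi := fun a => by apply Continuous.intervalIntegrable; fun_prop
  have hc0 : ∀ a : ℝ, IntervalIntegrable (fun _ : ℝ => a) volume 0 Real.pi := by simp
  rw [intervalIntegral.integral_add ((((hc0 _).add (hc1 _)).add (hc _ 2)).add (hc _ 3)) (hc _ 4),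
    intervalIntegral.integral_add (((hc0 _).add (hc1 _)).add (hc _ 2)) (hc _ 3),
    intervalIntegral.integral_add ((hc0 _).add (hc1 _)) (hc _ 2),
    intervalIntegral.integral_add (hc0 _) (hc1 _)]
  simp only [intervalIntegral.integral_const_mul, hi1, hi2, hi3, hi4,
    intervalIntegral.integral_const, smul_eq_mul]
  ring

/-- The shift with step `0`. -/
theorem asymShift_one {x : ℝ} (hx : x ∈ Ioo (-1 : ℝ) 1) (f : ℝ → ℝ) :
    asymShift 1 f x = Real.pi * f x := by
  have hx2 : 0 < 1 - x ^ 2 := by nlinarith [hx.1, hx.2]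
  have hu : √(1 - x ^ 2) ^ 2 = 1 - x ^ 2 := Real.sq_sqrt hx2.le
  have hB : ∀ z, shiftB 1 x z x = 1 - x ^ 2 := fun z => by
    simp only [shiftB, one_pow, sub_self, Real.sqrt_zero, mul_zero, zero_mul, add_zero, mul_one]
    linear_combination 2 * hu
  unfold asymShift
  simp only [shiftR_one, hB, intervalIntegral.integral_const, smul_eq_mul, sub_zero]
  field_simp

/-! ### Markov's inequality -/

open Polynomial in
theorem eval_one_derivative_le {P : ℝ[X]} {m : ℕ} (hP : P.natDegree ≤ m) {A : ℝ} (hA : 0 < A)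
    (hb : ∀ x ∈ Icc (-1 : ℝ) 1, |P.eval x| ≤ A) : |P.derivative.eval 1| ≤ m ^ 2 * A := by
  have key : ∀ R : ℝ[X], R.natDegree ≤ m → (∀ x ∈ Icc (-1 : ℝ) 1, |R.eval x| ≤ A) →
      R.derivative.eval 1 ≤ m ^ 2 * A := fun R hR hRb => by
    have h := Polynomial.Chebyshev.eval_iterate_derivative_le_of_forall_abs_le_one
      (n := m) (P := C A⁻¹ * R) (k := 1) (le_refl (1 : ℝ))
      (natDegree_le_iff_degree_le.1 ((natDegree_C_mul_le _ _).trans hR)) (fun x hx => by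
        rw [eval_mul, eval_C, abs_mul, abs_of_pos (inv_pos.2 hA), inv_mul_le_iff₀ hA, mul_one]
        exact hRb x hx)
    simp only [Function.iterate_one, Polynomial.Chebyshev.derivative_T_eval_one] at h
    rw [derivative_C_mul, eval_mul, eval_C, inv_mul_le_iff₀ hA] at h
    rw [mul_comm]
    exact_mod_cast h
  rw [abs_le]
  constructor
  · have h := key (-P) (by rwa [natDegree_neg]) fun x hx => by
      rw [eval_neg, abs_neg]; exact hb x hx
    rw [derivative_neg, eval_neg] at h
    linarith
  · exact key P hP hb

open Polynomial in
/-- Markov's inequality at the endpoint of `[-1, y]`, for every `y` in `[0, 1]`, controls the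
increment of a polynomial near `1`. -/
theorem abs_eval_sub_eval_one_le {P : ℝ[X]} {m : ℕ} (hm : 1 ≤ m) (hP : P.natDegree ≤ m) {A : ℝ}
    (hA : 0 < A) (hb : ∀ x ∈ Icc (-1 : ℝ) 1, |P.eval x| ≤ A) {y : ℝ} (hy : y ∈ Icc (-1 : ℝ) 1) :
    |P.eval y - P.eval 1| ≤ 2 * m ^ 2 * (1 - y) * A := by
  have hm1 : (1 : ℝ) ≤ m := by exact_mod_cast hm
  rcases lt_or_ge y 0 with h0 | h0
  · have h1 := hb y hy
    have h2 := hb 1 (by norm_num)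
    calc |P.eval y - P.eval 1| ≤ |P.eval y| + |P.eval 1| := abs_sub _ _
      _ ≤ 2 * 1 ^ 2 * 1 * A := by linarith
      _ ≤ 2 * m ^ 2 * (1 - y) * A := by gcongr; linarith
  have hder : ∀ s ∈ Icc y 1, ‖P.derivative.eval s‖ ≤ 2 * m ^ 2 * A := fun s hs => by
    have hs0 : 0 ≤ s := h0.trans hs.1
    set l : ℝ[X] := C ((1 + s) / 2) * X + C ((s - 1) / 2) with hl
    have h := eval_one_derivative_le (P := P.comp l) (m := m) (A := A) (by
        rw [natDegree_comp]
        calc P.natDegree * l.natDegree ≤ m * 1 :=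
              Nat.mul_le_mul hP (by rw [hl]; exact natDegree_linear_le)
          _ = m := mul_one m) hA (fun x hx => by
        rw [eval_comp]
        refine hb _ ?_
        simp only [hl, eval_add, eval_mul, eval_C, eval_X]
        constructor <;> nlinarith [hx.1, hx.2, hs.2])
    have hl1 : l.eval 1 = s := by simp only [hl, eval_add, eval_mul, eval_C, eval_X]; ring
    have hl' : l.derivative.eval 1 = (1 + s) / 2 := by simp [hl]
    rw [derivative_comp, eval_mul, eval_comp, hl1, hl', abs_mul,
      abs_of_pos (by linarith : (0 : ℝ) < (1 + s) / 2)] at h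
    rw [Real.norm_eq_abs]
    nlinarith [abs_nonneg (P.derivative.eval s)]
  have h := (convex_Icc y 1).norm_image_sub_le_of_norm_hasDerivWithin_le
    (fun s _ => (P.hasDerivAt s).hasDerivWithinAt) hder
    (right_mem_Icc.2 hy.2) (left_mem_Icc.2 hy.2)
  rw [Real.norm_eq_abs, Real.norm_eq_abs, abs_sub_comm y 1,
    abs_of_nonneg (by linarith [hy.2] : 0 ≤ 1 - y)] at h
  linarith

open Polynomial in
/-- The same estimate for polynomials with values in a normed space, by duality. -/
theorem norm_sub_le_of_forall_dual_polynomial {E : Type*} [NormedAddCommGroup E] [NormedSpace ℝ E]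
    {G : ℝ → E} {m : ℕ} (hm : 1 ≤ m)
    (hG : ∀ g : StrongDual ℝ E, ∃ P : ℝ[X], P.natDegree ≤ m ∧
      ∀ y ∈ Icc (-1 : ℝ) 1, g (G y) = P.eval y)
    {A : ℝ} (hb : ∀ y ∈ Icc (-1 : ℝ) 1, ‖G y‖ ≤ A) {y : ℝ} (hy : y ∈ Icc (-1 : ℝ) 1) :
    ‖G y - G 1‖ ≤ 2 * m ^ 2 * (1 - y) * A := by
  have h1 : (1 : ℝ) ∈ Icc (-1 : ℝ) 1 := by norm_num
  have hA : 0 ≤ A := (norm_nonneg _).trans (hb 1 h1)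
  obtain ⟨g, hg, hgv⟩ := exists_dual_vector'' ℝ (G y - G 1)
  obtain ⟨P, hP, hPe⟩ := hG g
  have hPb : ∀ B, A ≤ B → ∀ x ∈ Icc (-1 : ℝ) 1, |P.eval x| ≤ B := fun B hB x hx => by
    rw [← hPe x hx, ← Real.norm_eq_abs]
    calc ‖g (G x)‖ ≤ ‖g‖ * ‖G x‖ := g.le_opNorm _
      _ ≤ 1 * A := by gcongr; exact hb x hx
      _ ≤ B := by linarith
  have hval : ‖G y - G 1‖ = P.eval y - P.eval 1 := by
    rw [← hPe y hy, ← hPe 1 h1, ← map_sub, hgv]; rfl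
  rw [hval]
  have hc : 0 ≤ 2 * (m : ℝ) ^ 2 * (1 - y) := by
    have := hy.2
    have : 0 ≤ 1 - y := by linarith
    positivity
  refine le_of_forall_pos_le_add fun ε hε => ?_
  set c := 2 * (m : ℝ) ^ 2 * (1 - y) with hcdef
  have hε' : 0 < ε / (c + 1) := by positivity
  have h := (le_abs_self _).trans (abs_eval_sub_eval_one_le hm hP (A := A + ε / (c + 1))
    (by linarith) (hPb _ (by linarith)) hy)
  rw [← hcdef] at h
  have h2 : c * (ε / (c + 1)) ≤ ε := by
    rw [mul_div_assoc', div_le_iff₀ (by linarith)]; nlinarith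
  linarith

/-! ### The difference of a polynomial -/

open Polynomial in
theorem memLpWeighted_polynomial (p : ℝ≥0∞) {α : ℝ} (hα : 0 ≤ α) (Q : ℝ[X]) :
    MemLpWeighted p α fun x => Q.eval x := by
  have hc : Continuous fun x : ℝ => Q.eval x * (1 - x ^ 2) ^ α :=
    Q.continuous.mul ((continuous_const.sub (continuous_id.pow 2)).rpow_const
      fun _ => Or.inr hα)
  obtain ⟨K, hK⟩ := isCompact_Icc.exists_bound_of_continuousOn
    (s := Icc (-1 : ℝ) 1) hc.continuousOn
  refine MemLp.of_bound hc.aestronglyMeasurable K ?_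
  exact (ae_restrict_mem measurableSet_Icc).mono hK

theorem AdmissibleExponents.pos {p : ℝ≥0∞} {α : ℝ} (h : AdmissibleExponents p α) : 0 < α := by
  obtain ⟨hp, h1, h2⟩ := h
  by_cases hpt : p = ∞
  · linarith [(h2 hpt).1]
  · have hp1 : 1 ≤ p.toReal := by
      rw [← ENNReal.toReal_one]; exact ENNReal.toReal_mono hpt hp
    have : 1 / (2 * p.toReal) ≤ 1 / 2 := by
      apply one_div_le_one_div_of_le <;> linarith
    linarith [(h1 hpt).1]

open Polynomial in
/-- Markov's inequality in the shift parameter: `y ↦ asymShift y Q` is a polynomial of degree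
`N + 2` with values in `L_{p,α}`, bounded on `[-1, 1]`. -/
theorem weightedNorm_asymShift_sub_le {p : ℝ≥0∞} {α : ℝ} (h : AdmissibleExponents p α)
    {K : ℝ≥0∞} (hK : K ≠ ∞)
    (hKb : ∀ y ∈ Icc (-1 : ℝ) 1, ∀ f : ℝ → ℝ, MemLpWeighted p α f →
      weightedNorm p α (asymShift y f) ≤ K * weightedNorm p α f)
    {N : ℕ} {Q : ℝ[X]} (hQ : Q.natDegree ≤ N) {y : ℝ} (hy : y ∈ Icc (-1 : ℝ) 1) :
    weightedNorm p α (fun x => asymShift y (fun s => Q.eval s) x -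
        asymShift 1 (fun s => Q.eval s) x) ≤
      ENNReal.ofReal (2 * (N + 2) ^ 2 * (1 - y)) *
        (K * weightedNorm p α fun s => Q.eval s) := by
  have : Fact (1 ≤ p) := ⟨h.1⟩
  have hQm : MemLpWeighted p α fun s => Q.eval s := memLpWeighted_polynomial p h.pos.le Q
  have h1 : (1 : ℝ) ∈ Icc (-1 : ℝ) 1 := by norm_num
  have hm : ∀ s : Icc (-1 : ℝ) 1, MemLp (fun x => asymShift s (fun s => Q.eval s) x *
      (1 - x ^ 2) ^ α) p segMeasure := fun s => hQm.asymShift h s.2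
  classical
  set G : ℝ → Lp ℝ p segMeasure := fun s =>
    if hs : s ∈ Icc (-1 : ℝ) 1 then (hm ⟨s, hs⟩).toLp _ else 0 with hGdef
  have hG : ∀ s (hs : s ∈ Icc (-1 : ℝ) 1), G s = (hm ⟨s, hs⟩).toLp _ := fun s hs => by
    simp only [hGdef, dif_pos hs]
  set B := K * weightedNorm p α fun s => Q.eval s with hB
  have hBt : B ≠ ∞ := ENNReal.mul_ne_top hK hQm.weightedNorm_lt_top.ne
  -- Lagrange interpolation in the shift parameter expresses every shift through finitely many.
  set S := Finset.range (N + 3) with hS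
  set v : ℕ → ℝ := fun i => 1 / ((i : ℝ) + 1) with hv
  have hvinj : Set.InjOn v S := fun i _ j _ hij => by
    simp only [hv, one_div, inv_inj, add_left_inj] at hij
    exact_mod_cast hij
  have hvI : ∀ i, v i ∈ Icc (-1 : ℝ) 1 := fun i => by
    have hi : (0 : ℝ) ≤ i := i.cast_nonneg
    refine ⟨(by norm_num : (-1 : ℝ) ≤ 0).trans (by simp only [hv]; positivity), ?_⟩
    simp only [hv]
    rw [div_le_one (by linarith)]; linarith
  have hinterp : ∀ s ∈ Icc (-1 : ℝ) 1,
      G s = ∑ i ∈ S, (Lagrange.basis S v i).eval s • G (v i) := fun s hs => by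
    have hpt : ∀ x, asymShift s (fun s => Q.eval s) x * (1 - x ^ 2) ^ α =
        ∑ i ∈ S, (Lagrange.basis S v i).eval s •
          (asymShift (v i) (fun s => Q.eval s) x * (1 - x ^ 2) ^ α) := fun x => by
      obtain ⟨q, hq, hqe⟩ := exists_asymShift_eq_eval_right hQ x
      have hdeg : q.degree < S.card := by
        rw [hS, Finset.card_range]
        exact (natDegree_le_iff_degree_le.1 hq).trans_lt (by exact_mod_cast Nat.lt_succ_self _)
      have he := congrArg (Polynomial.eval s) (Lagrange.eq_interpolate hvinj hdeg)
      rw [Lagrange.interpolate_apply, eval_finsetSum] at he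
      rw [hqe s hs, he, Finset.sum_mul]
      refine Finset.sum_congr rfl fun i _ => ?_
      rw [hqe _ (hvI i), eval_mul, eval_C, smul_eq_mul]; ring
    rw [hG s hs]
    refine Lp.ext ?_
    have hi : ∀ i ∈ S, ((Lagrange.basis S v i).eval s • G (v i) : Lp ℝ p segMeasure)
        =ᵐ[segMeasure] fun x => (Lagrange.basis S v i).eval s •
          (asymShift (v i) (fun s => Q.eval s) x * (1 - x ^ 2) ^ α) := fun i _ => by
      rw [hG _ (hvI i)]
      filter_upwards [Lp.coeFn_smul ((Lagrange.basis S v i).eval s) ((hm ⟨v i, hvI i⟩).toLp _),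
        (hm ⟨v i, hvI i⟩).coeFn_toLp] with x hx1 hx2
      rw [hx1, Pi.smul_apply, hx2]
    have hall := (Finset.eventually_all S).2 hi
    filter_upwards [(hm ⟨s, hs⟩).coeFn_toLp, Lp.coeFn_finsetSum S
      (fun i => (Lagrange.basis S v i).eval s • G (v i)), hall] with x hx1 hx2 hx3
    rw [hx1, hx2, hpt x, Finset.sum_apply]
    exact Finset.sum_congr rfl fun i hi' => (hx3 i hi').symm
  have hdual : ∀ g : StrongDual ℝ (Lp ℝ p segMeasure), ∃ P : ℝ[X], P.natDegree ≤ N + 2 ∧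
      ∀ s ∈ Icc (-1 : ℝ) 1, g (G s) = P.eval s := fun g => by
    refine ⟨∑ i ∈ S, C (g (G (v i))) * Lagrange.basis S v i, ?_, fun s hs => ?_⟩
    · refine natDegree_sum_le_of_forall_le _ _ fun i hi => (natDegree_C_mul_le _ _).trans ?_
      rw [Lagrange.natDegree_basis hvinj hi, hS, Finset.card_range]
      omega
    · rw [hinterp s hs, map_sum, eval_finsetSum]
      refine Finset.sum_congr rfl fun i _ => ?_
      rw [map_smul, eval_mul, eval_C, smul_eq_mul, mul_comm]
  have hbound : ∀ s ∈ Icc (-1 : ℝ) 1, ‖G s‖ ≤ B.toReal := fun s hs => by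
    rw [hG s hs, Lp.norm_toLp]
    exact ENNReal.toReal_mono hBt (hKb s hs _ hQm)
  have hfin := norm_sub_le_of_forall_dual_polynomial (by omega) hdual hbound hy
  rw [hG y hy, hG 1 h1, ← MemLp.toLp_sub, Lp.norm_toLp] at hfin
  have hne := ((hm ⟨y, hy⟩).sub (hm ⟨1, h1⟩)).2.ne
  have hfin' := ENNReal.ofReal_le_ofReal hfin
  rw [ENNReal.ofReal_toReal hne, ENNReal.ofReal_mul' ENNReal.toReal_nonneg,
    ENNReal.ofReal_toReal hBt] at hfin'
  unfold weightedNorm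
  simp only [sub_mul]
  push_cast at hfin'
  exact hfin'

theorem cos_half_pow_four_eq (t : ℝ) : Real.cos (t / 2) ^ 4 = ((1 + Real.cos t) / 2) ^ 2 := by
  have h := Real.cos_sq (t / 2)
  rw [show 2 * (t / 2) = t by ring] at h
  calc Real.cos (t / 2) ^ 4 = (Real.cos (t / 2) ^ 2) ^ 2 := by ring
    _ = _ := by rw [h]; ring

theorem cos_half_pow_four_pos_le {δ₀ t : ℝ} (hδ₀ : δ₀ < Real.pi) (ht : |t| ≤ δ₀) :
    0 < Real.cos (δ₀ / 2) ^ 4 ∧ Real.cos (δ₀ / 2) ^ 4 ≤ Real.cos (t / 2) ^ 4 := by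
  have h0 : 0 ≤ δ₀ := (abs_nonneg t).trans ht
  have hpos : 0 < Real.cos (δ₀ / 2) := Real.cos_pos_of_mem_Ioo ⟨by linarith [Real.pi_pos],
    by linarith⟩
  refine ⟨by positivity, pow_le_pow_left₀ hpos.le ?_ 4⟩
  rw [← Real.cos_abs (t / 2), abs_div, abs_two]
  exact Real.cos_le_cos_of_nonneg_of_le_pi (by positivity) (by linarith) (by linarith)

theorem genShift_const_ae {t : ℝ} (ht : |t| < Real.pi) (c : ℝ) :
    genShift t (fun _ => c) =ᵐ[segMeasure] fun _ => c := by
  have hc := (cos_half_pow_four_pos_le ht le_rfl).1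
  have hc' : 0 < Real.cos (t / 2) ^ 4 := hc.trans_le (cos_half_pow_four_pos_le ht le_rfl).2
  filter_upwards [ae_segMeasure_mem_Ioo] with x hx
  rw [genShift_eq_asymShift, asymShift_const hx ⟨Real.neg_one_le_cos t, Real.cos_le_one t⟩,
    ← cos_half_pow_four_eq]
  exact inv_mul_cancel_left₀ (mul_pos Real.pi_pos hc').ne' c

theorem genDiff_const_ae (c : ℝ) : ∀ (r : ℕ) (t : Fin (r + 1) → ℝ), (∀ j, |t j| < Real.pi) →
    genDiff (r + 1) t (fun _ => c) =ᵐ[segMeasure] fun _ => 0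
  | 0, t, ht => by
    filter_upwards [genShift_const_ae (ht (Fin.last 0)) c] with x hx
    simp only [genDiff, hx, sub_self]
  | r + 1, t, ht => by
    have ih := genDiff_const_ae c r (fun j => t j.castSucc) fun j => ht j.castSucc
    filter_upwards [ih, genShift_congr_ae (t (Fin.last (r + 1))) ih,
      genShift_const_ae (ht (Fin.last (r + 1))) 0] with x h1 h2 h3
    simp only [genDiff] at h1 h2 ⊢
    rw [h2, h1, h3, sub_zero]

/-- For steps bounded away from `π`, differences of order `r` are bounded on `L_{p,α}`. -/
theorem exists_weightedNorm_genDiff_le {p : ℝ≥0∞} {α : ℝ} (h : AdmissibleExponents p α)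
    {δ₀ : ℝ} (hδ₀ : δ₀ < Real.pi) :
    ∃ K : ℝ, 0 ≤ K ∧ ∀ f : ℝ → ℝ, MemLpWeighted p α f → ∀ (r : ℕ) (t : Fin r → ℝ),
      (∀ j, |t j| ≤ δ₀) →
      weightedNorm p α (genDiff r t f) ≤ ENNReal.ofReal (K ^ r) * weightedNorm p α f := by
  obtain ⟨k, hk, hkb⟩ := exists_weightedNorm_asymShift_le h
  set c := (Real.pi * Real.cos (δ₀ / 2) ^ 4)⁻¹ with hc
  have hc0 : 0 ≤ c := inv_nonneg.2 (mul_nonneg Real.pi_pos.le (by positivity))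
  have hK0 : 0 ≤ c * k.toReal + 1 := by positivity
  refine ⟨c * k.toReal + 1, hK0, fun f hf r => ?_⟩
  induction r with
  | zero => intro t _; simp [genDiff]
  | succ r ih =>
    intro t ht
    have hg := hf.genDiff h r fun j => t j.castSucc
    have ihr := ih (fun j => t j.castSucc) fun j => ht j.castSucc
    set g := genDiff r (fun j => t j.castSucc) f
    set s := t (Fin.last r) with hs
    have hcs := cos_half_pow_four_pos_le hδ₀ (ht (Fin.last r))
    have hb : weightedNorm p α (genShift s g) ≤
        ENNReal.ofReal (c * k.toReal) * weightedNorm p α g := by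
      have e : genShift s g = fun x => (Real.pi * Real.cos (s / 2) ^ 4)⁻¹ *
          asymShift (Real.cos s) g x := funext fun x => genShift_eq_asymShift s g x
      rw [e, weightedNorm_const_mul, ENNReal.ofReal_mul hc0, ENNReal.ofReal_toReal hk, mul_assoc]
      refine mul_le_mul' ?_
        (hkb _ ⟨Real.neg_one_le_cos s, Real.cos_le_one s⟩ g hg).1
      have hpos : 0 < Real.pi * Real.cos (s / 2) ^ 4 :=
        mul_pos Real.pi_pos (hcs.1.trans_le hcs.2)
      rw [Real.enorm_of_nonneg (inv_nonneg.2 hpos.le)]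
      exact ENNReal.ofReal_le_ofReal (inv_anti₀ (mul_pos Real.pi_pos hcs.1)
        (mul_le_mul_of_nonneg_left hcs.2 Real.pi_pos.le))
    calc weightedNorm p α (genDiff (r + 1) t f)
        ≤ weightedNorm p α (genShift s g) + weightedNorm p α g :=
          weightedNorm_sub_le h.1 (hg.genShift h s) hg
      _ ≤ ENNReal.ofReal (c * k.toReal) * weightedNorm p α g + weightedNorm p α g := by gcongr
      _ = ENNReal.ofReal (c * k.toReal + 1) * weightedNorm p α g := by
          rw [ENNReal.ofReal_add (by positivity) zero_le_one, ENNReal.ofReal_one, add_mul, one_mul]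
      _ ≤ ENNReal.ofReal (c * k.toReal + 1) *
            (ENNReal.ofReal ((c * k.toReal + 1) ^ r) * weightedNorm p α f) := by gcongr
      _ = _ := by rw [← mul_assoc, ← ENNReal.ofReal_mul hK0, pow_succ']

open Polynomial in
/-- A difference with step `t` of a polynomial of degree at most `N` is smaller than the
polynomial itself by a factor of order `((N + 1) t)²`. -/
theorem exists_weightedNorm_genShift_polynomial_sub_le {p : ℝ≥0∞} {α : ℝ}
    (h : AdmissibleExponents p α) {δ₀ : ℝ} (hδ₀ : δ₀ < Real.pi) :
    ∃ K : ℝ, 0 ≤ K ∧ ∀ (N : ℕ) (Q : ℝ[X]), Q.natDegree ≤ N → ∀ t : ℝ, |t| ≤ δ₀ →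
      weightedNorm p α (fun x => genShift t (fun s => Q.eval s) x - Q.eval x) ≤
        ENNReal.ofReal (K * ((N + 1) * t) ^ 2) * weightedNorm p α fun s => Q.eval s := by
  obtain ⟨k, hk, hkb⟩ := exists_weightedNorm_asymShift_le h
  set c₀ := Real.cos (δ₀ / 2) ^ 4 with hc₀
  have hc₀0 : 0 ≤ c₀ := by positivity
  refine ⟨(c₀⁻¹ + 4) * k.toReal, by positivity, fun N Q hQ t ht => ?_⟩
  have hQm : MemLpWeighted p α fun s => Q.eval s := memLpWeighted_polynomial p h.pos.le Q
  obtain ⟨hc₀pos, hct⟩ := cos_half_pow_four_pos_le hδ₀ ht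
  rw [← hc₀] at hc₀pos hct
  have hy : Real.cos t ∈ Icc (-1 : ℝ) 1 := ⟨Real.neg_one_le_cos t, Real.cos_le_one t⟩
  have hpi := Real.pi_pos
  set y := Real.cos t with hydef
  set c := Real.cos (t / 2) ^ 4 with hcdef
  have hcpos : 0 < c := hc₀pos.trans_le hct
  have hyt : 1 - y ≤ t ^ 2 / 2 := by linarith [Real.one_sub_sq_div_two_le_cos (x := t)]
  have hc1 : 1 - c ≤ 1 - y := by
    rw [hcdef, cos_half_pow_four_eq, ← hydef]; nlinarith [hy.1, hy.2]
  have hc1' : 0 ≤ 1 - c := by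
    rw [hcdef, cos_half_pow_four_eq, ← hydef]; nlinarith [hy.1, hy.2]
  have hcinv : c⁻¹ - 1 = (1 - c) / c := by field_simp
  have hd0 : 0 ≤ Real.pi⁻¹ * (c⁻¹ - 1) := by rw [hcinv]; positivity
  have h1I : (1 : ℝ) ∈ Icc (-1 : ℝ) 1 := by norm_num
  have hae : (fun x => genShift t (fun s => Q.eval s) x - Q.eval x) =ᵐ[segMeasure]
      fun x => Real.pi⁻¹ * (c⁻¹ - 1) * asymShift y (fun s => Q.eval s) x +
        Real.pi⁻¹ * (asymShift y (fun s => Q.eval s) x - asymShift 1 (fun s => Q.eval s) x) := by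
    filter_upwards [ae_segMeasure_mem_Ioo] with x hx
    rw [genShift_eq_asymShift, asymShift_one hx, ← hydef, ← hcdef]
    field_simp
    ring
  have hm := hQm.asymShift h hy
  have hm1 := hQm.asymShift h h1I
  set W := weightedNorm p α fun s => Q.eval s with hW
  have hkr : k = ENNReal.ofReal k.toReal := (ENNReal.ofReal_toReal hk).symm
  have hN : (0 : ℝ) ≤ N := N.cast_nonneg
  have h1y : 0 ≤ 1 - y := by linarith [hy.2]
  rw [weightedNorm_congr_ae hae]
  calc _ ≤ weightedNorm p α (fun x => Real.pi⁻¹ * (c⁻¹ - 1) * asymShift y (fun s => Q.eval s) x) +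
        weightedNorm p α (fun x => Real.pi⁻¹ *
          (asymShift y (fun s => Q.eval s) x - asymShift 1 (fun s => Q.eval s) x)) :=
        weightedNorm_add_le h.1 (hm.const_mul _) ((hm.sub hm1).const_mul _)
    _ ≤ ENNReal.ofReal (Real.pi⁻¹ * (c⁻¹ - 1)) * (k * W) + ENNReal.ofReal Real.pi⁻¹ *
          (ENNReal.ofReal (2 * (N + 2) ^ 2 * (1 - y)) * (k * W)) := by
        rw [weightedNorm_const_mul, weightedNorm_const_mul, Real.enorm_of_nonneg hd0,
          Real.enorm_of_nonneg (inv_nonneg.2 hpi.le)]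
        gcongr
        · exact (hkb y hy _ hQm).1
        · exact weightedNorm_asymShift_sub_le h hk (fun y hy f hf => (hkb y hy f hf).1) hQ hy
    _ = ENNReal.ofReal ((Real.pi⁻¹ * (c⁻¹ - 1) + Real.pi⁻¹ * (2 * (N + 2) ^ 2 * (1 - y))) *
          k.toReal) * W := by
        have hs0 : 0 ≤ Real.pi⁻¹ * (2 * ((N : ℝ) + 2) ^ 2 * (1 - y)) := by positivity
        rw [ENNReal.ofReal_mul (add_nonneg hd0 hs0) (q := k.toReal), ENNReal.ofReal_add hd0 hs0,
          ENNReal.ofReal_mul (inv_nonneg.2 hpi.le) (q := 2 * (N + 2) ^ 2 * (1 - y)), ← hkr]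
        ring
    _ ≤ _ := by
        refine mul_le_mul' (ENNReal.ofReal_le_ofReal ?_) le_rfl
        have hpi1 : Real.pi⁻¹ ≤ 1 := inv_le_one_of_one_le₀ (by linarith [Real.pi_gt_three])
        have e1 : c⁻¹ - 1 ≤ c₀⁻¹ * (t ^ 2 / 2) := by
          rw [hcinv, div_eq_inv_mul]
          exact mul_le_mul (inv_anti₀ hc₀pos hct) (hc1.trans hyt) hc1' (by positivity)
        have e0 : 0 ≤ c⁻¹ - 1 := by rw [hcinv]; positivity
        have e2 : (2 * ((N : ℝ) + 2) ^ 2 * (1 - y)) ≤ 4 * ((N + 1) * t) ^ 2 := by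
          calc (2 * ((N : ℝ) + 2) ^ 2 * (1 - y)) ≤ 2 * (2 * (N + 1)) ^ 2 * (t ^ 2 / 2) := by
                gcongr; linarith
            _ = _ := by ring
        have e3 : c₀⁻¹ * (t ^ 2 / 2) ≤ c₀⁻¹ * ((N + 1) * t) ^ 2 := by
          gcongr
          nlinarith [sq_nonneg t, mul_nonneg hN (sq_nonneg t),
            mul_nonneg (mul_nonneg hN hN) (sq_nonneg t)]
        calc (Real.pi⁻¹ * (c⁻¹ - 1) + Real.pi⁻¹ * (2 * (N + 2) ^ 2 * (1 - y))) * k.toReal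
            ≤ (1 * (c⁻¹ - 1) + 1 * (2 * (N + 2) ^ 2 * (1 - y))) * k.toReal := by gcongr
          _ ≤ (c₀⁻¹ * ((N + 1) * t) ^ 2 + 4 * ((N + 1) * t) ^ 2) * k.toReal := by
              refine mul_le_mul_of_nonneg_right ?_ ENNReal.toReal_nonneg
              linarith
          _ = _ := by ring

open Polynomial in
/-- Differences of polynomials are polynomials of no larger degree, so the estimate for one
difference can be iterated. -/
theorem exists_weightedNorm_genDiff_polynomial_le {p : ℝ≥0∞} {α : ℝ}
    (h : AdmissibleExponents p α) {δ₀ : ℝ} (hδ₀ : δ₀ < Real.pi) :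
    ∃ K : ℝ, 0 ≤ K ∧ ∀ (N : ℕ) (Q : ℝ[X]), Q.natDegree ≤ N → ∀ δ : ℝ, δ ≤ δ₀ →
      ∀ (r : ℕ) (t : Fin r → ℝ), (∀ j, |t j| ≤ δ) →
      weightedNorm p α (genDiff r t fun s => Q.eval s) ≤
        ENNReal.ofReal ((K * ((N + 1) * δ) ^ 2) ^ r) * weightedNorm p α fun s => Q.eval s := by
  obtain ⟨K, hK, hKb⟩ := exists_weightedNorm_genShift_polynomial_sub_le h hδ₀
  refine ⟨K, hK, fun N Q hQ δ hδ r t ht => ?_⟩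
  suffices H : ∀ (r : ℕ) (t : Fin r → ℝ), (∀ j, |t j| ≤ δ) → ∃ q : ℝ[X], q.natDegree ≤ N ∧
      genDiff r t (fun s => Q.eval s) =ᵐ[segMeasure] (fun s => q.eval s) ∧
      weightedNorm p α (fun s => q.eval s) ≤
        ENNReal.ofReal ((K * ((N + 1) * δ) ^ 2) ^ r) * weightedNorm p α fun s => Q.eval s by
    obtain ⟨q, -, hq, hqb⟩ := H r t ht
    rwa [weightedNorm_congr_ae hq]
  clear t ht r
  intro r
  induction r with
  | zero => intro t _; exact ⟨Q, hQ, Filter.EventuallyEq.rfl, by simp⟩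
  | succ r ih =>
    intro t ht
    obtain ⟨q, hqN, hq, hqb⟩ := ih (fun j => t j.castSucc) fun j => ht j.castSucc
    set s := t (Fin.last r) with hs
    have hy : Real.cos s ∈ Icc (-1 : ℝ) 1 := ⟨Real.neg_one_le_cos s, Real.cos_le_one s⟩
    obtain ⟨q', hq'N, hq'⟩ := exists_asymShift_eq_eval_left hqN hy
    have hst : genShift s (fun s => q.eval s) =ᵐ[segMeasure]
        fun x => (Real.pi * Real.cos (s / 2) ^ 4)⁻¹ * q'.eval x := by
      filter_upwards [ae_segMeasure_mem_Ioo] with x hx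
      rw [genShift_eq_asymShift, hq' x hx]
    have hlast : genDiff (r + 1) t (fun s => Q.eval s) =ᵐ[segMeasure]
        fun x => genShift s (fun s => q.eval s) x - q.eval x := by
      filter_upwards [hq, genShift_congr_ae s hq] with x h1 h2
      simp only [genDiff] at h1 h2 ⊢
      rw [← hs, h1, h2]
    have hpoly : (fun x => genShift s (fun s => q.eval s) x - q.eval x) =ᵐ[segMeasure]
        fun x => (C ((Real.pi * Real.cos (s / 2) ^ 4)⁻¹) * q' - q).eval x := by
      filter_upwards [hst] with x hx
      rw [hx, eval_sub, eval_mul, eval_C]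
    refine ⟨C ((Real.pi * Real.cos (s / 2) ^ 4)⁻¹) * q' - q,
      (natDegree_sub_le _ _).trans (max_le ((natDegree_C_mul_le _ _).trans hq'N) hqN),
      hlast.trans hpoly, ?_⟩
    rw [← weightedNorm_congr_ae hpoly]
    have hsδ : |s| ≤ δ := ht (Fin.last r)
    have hδ0 : 0 ≤ δ := (abs_nonneg s).trans hsδ
    calc _ ≤ ENNReal.ofReal (K * ((N + 1) * s) ^ 2) * weightedNorm p α fun s => q.eval s :=
          hKb N q hqN s (hsδ.trans hδ)
      _ ≤ ENNReal.ofReal (K * ((N + 1) * δ) ^ 2) *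
          (ENNReal.ofReal ((K * ((N + 1) * δ) ^ 2) ^ r) *
            weightedNorm p α fun s => Q.eval s) := by
          refine mul_le_mul' (ENNReal.ofReal_le_ofReal ?_) hqb
          rw [mul_pow, mul_pow, ← sq_abs s]
          gcongr
      _ = _ := by rw [← mul_assoc, ← ENNReal.ofReal_mul (by positivity),
          pow_succ' (K * ((N + 1) * δ) ^ 2) r]

/-! ### Summation over dyadic degrees -/

open Polynomial in
theorem exists_polynomial_weightedNorm_sub_le {p : ℝ≥0∞} {α : ℝ} {f : ℝ → ℝ} {n : ℕ} (hn : 1 ≤ n)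
    {M lam : ℝ} (hM : 0 < M)
    (hE : bestApprox p α n f ≤ ENNReal.ofReal (M * (n : ℝ) ^ (-lam))) :
    ∃ P : ℝ[X], P.natDegree ≤ n - 1 ∧
      weightedNorm p α (fun x => f x - P.eval x) ≤ ENNReal.ofReal (2 * M * (n : ℝ) ^ (-lam)) := by
  have hn0 : (0 : ℝ) < n := by exact_mod_cast hn
  have hpos : 0 < M * (n : ℝ) ^ (-lam) := by positivity
  have hlt : bestApprox p α n f < ENNReal.ofReal (2 * M * (n : ℝ) ^ (-lam)) :=
    hE.trans_lt ((ENNReal.ofReal_lt_ofReal_iff (by positivity)).2 (by linarith))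
  unfold bestApprox at hlt
  simp only [iInf_lt_iff] at hlt
  obtain ⟨P, hP, hPb⟩ := hlt
  refine ⟨P, ?_, hPb.le⟩
  rcases eq_or_ne P 0 with rfl | hP0
  · simp
  · have := (natDegree_lt_iff_degree_lt hP0).2 hP
    omega

open Polynomial in
/-- Telescoping along `P 0, P 1, …`, where `P 0` is a constant, which differences annihilate. -/
theorem weightedNorm_genDiff_telescope_le {p : ℝ≥0∞} {α : ℝ} (h : AdmissibleExponents p α) {r : ℕ}
    (hr : 1 ≤ r) {t : Fin r → ℝ} (ht : ∀ j, |t j| < Real.pi) {P : ℕ → ℝ[X]}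
    (hP : (P 0).natDegree = 0) (N : ℕ) :
    weightedNorm p α (genDiff r t fun x => (P N).eval x) ≤
      ∑ k ∈ Finset.range N,
        weightedNorm p α (genDiff r t fun x => (P (k + 1) - P k).eval x) := by
  induction N with
  | zero =>
    obtain ⟨r, rfl⟩ : ∃ s, r = s + 1 := ⟨r - 1, by omega⟩
    rw [eq_C_of_natDegree_eq_zero hP]
    simp only [eval_C]
    rw [weightedNorm_congr_ae (genDiff_const_ae _ r t ht)]
    simp [weightedNorm]
  | succ N ih =>
    rw [Finset.sum_range_succ]
    have e : (fun x => (P (N + 1)).eval x) =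
        fun x => (P N).eval x + (P (N + 1) - P N).eval x := by
      funext x; rw [eval_sub]; ring
    rw [e]
    exact (weightedNorm_genDiff_add_le h (memLpWeighted_polynomial p h.pos.le _)
      (memLpWeighted_polynomial p h.pos.le _) r t).trans (by gcongr)

/-- The dyadic sum: the terms grow geometrically with ratio `2 ^ (2 r - λ) > 1`, so that the sum
is comparable with its last term. -/
theorem sum_dyadic_le {K M lam δ D : ℝ} {r : ℕ} (hK : 0 ≤ K) (hM : 0 ≤ M)
    (hlam : lam < 2 * (r : ℝ)) (hδ : 0 < δ) {N : ℕ} (hD : D = 2 ^ N) (hDδ : D ≤ Real.pi / δ) :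
    ∑ k ∈ Finset.range N, (K * (2 ^ (k + 1) * δ) ^ 2) ^ r * (4 * M * (2 ^ k : ℝ) ^ (-lam)) ≤
      4 * (4 * K) ^ r * (Real.pi ^ (2 * r - lam) / (2 ^ (2 * r - lam) - 1)) * M * δ ^ lam := by
  set ρ : ℝ := 2 ^ (2 * r - lam) with hρ
  have hρ1 : 1 < ρ := Real.one_lt_rpow (by norm_num) (by linarith)
  have hρk : ∀ k : ℕ, ρ ^ k = (2 ^ k : ℝ) ^ (2 * r - lam) := fun k => by
    rw [hρ, ← Real.rpow_natCast, ← Real.rpow_natCast, ← Real.rpow_mul (by norm_num),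
      ← Real.rpow_mul (by norm_num), mul_comm]
  have hterm : ∀ k : ℕ, (K * (2 ^ (k + 1) * δ) ^ 2) ^ r * (4 * M * (2 ^ k : ℝ) ^ (-lam)) =
      4 * (4 * K) ^ r * M * δ ^ (2 * r) * ρ ^ k := fun k => by
    have h2 : (0 : ℝ) < 2 ^ k := by positivity
    rw [hρk, sub_eq_add_neg, Real.rpow_add h2]
    have e : (2 ^ k : ℝ) ^ (2 * (r : ℝ)) = (2 ^ k) ^ (2 * r) := by
      rw [← Real.rpow_natCast (2 ^ k) (2 * r)]; push_cast; rfl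
    rw [e]
    have e2 : (K * (2 ^ (k + 1) * δ) ^ 2) ^ r = (4 * K) ^ r * δ ^ (2 * r) * (2 ^ k) ^ (2 * r) := by
      rw [pow_mul, pow_mul, ← mul_pow, ← mul_pow]; congr 1; ring
    rw [e2]; ring
  simp only [hterm]
  rw [← Finset.mul_sum, geom_sum_eq hρ1.ne']
  have hlast : δ ^ (2 * r) * ρ ^ N ≤ Real.pi ^ (2 * r - lam) * δ ^ lam := by
    rw [hρk, ← hD]
    have hD0 : 0 < D := by rw [hD]; positivity
    calc δ ^ (2 * r) * D ^ (2 * r - lam) ≤ δ ^ (2 * r) * (Real.pi / δ) ^ (2 * r - lam) := by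
          gcongr
      _ = Real.pi ^ (2 * r - lam) * δ ^ lam := by
          rw [Real.div_rpow Real.pi_pos.le hδ.le, Real.rpow_sub hδ]
          have e : δ ^ (2 * (r : ℝ)) = δ ^ (2 * r) := by
            rw [← Real.rpow_natCast]; push_cast; rfl
          rw [e]
          have := Real.rpow_pos_of_pos hδ lam
          field_simp
  have hρ0 : 0 < ρ - 1 := by linarith
  calc 4 * (4 * K) ^ r * M * δ ^ (2 * r) * ((ρ ^ N - 1) / (ρ - 1))
      ≤ 4 * (4 * K) ^ r * M * δ ^ (2 * r) * (ρ ^ N / (ρ - 1)) := by gcongr; linarith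
    _ = 4 * (4 * K) ^ r * M / (ρ - 1) * (δ ^ (2 * r) * ρ ^ N) := by ring
    _ ≤ 4 * (4 * K) ^ r * M / (ρ - 1) * (Real.pi ^ (2 * r - lam) * δ ^ lam) := by gcongr
    _ = _ := by ring

open Polynomial in
theorem exists_genModulus_le_of_pos {p : ℝ≥0∞} {α : ℝ} (h : AdmissibleExponents p α)
    {r : ℕ} (hr : 1 ≤ r) {lam : ℝ} (hlam : 0 < lam) (hlam_lt : lam < 2 * (r : ℝ))
    {δ₀ : ℝ} (hδ₀ : δ₀ < Real.pi) :
    ∃ C : ℝ, 0 < C ∧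
      ∀ f : ℝ → ℝ, MemLpWeighted p α f →
      ∀ M : ℝ, 0 < M →
        (∀ n : ℕ, 1 ≤ n → bestApprox p α n f ≤ ENNReal.ofReal (M * (n : ℝ) ^ (-lam))) →
        ∀ δ : ℝ, 0 < δ → δ ≤ δ₀ →
          genModulus p α r f δ ≤ ENNReal.ofReal (C * M * δ ^ lam) := by
  obtain ⟨K₁, hK₁, hb₁⟩ := exists_weightedNorm_genDiff_le h hδ₀
  obtain ⟨K₂, hK₂, hb₂⟩ := exists_weightedNorm_genDiff_polynomial_le h hδ₀
  set C₂ := 4 * (4 * K₂) ^ r * (Real.pi ^ (2 * r - lam) / (2 ^ (2 * r - lam) - 1)) with hC₂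
  have hρ1 : (1 : ℝ) < 2 ^ (2 * r - lam) := Real.one_lt_rpow (by norm_num) (by linarith)
  have hC₂0 : 0 ≤ C₂ := by
    have : (0 : ℝ) ≤ 2 ^ (2 * r - lam) - 1 := by linarith
    have := Real.pi_pos
    positivity
  refine ⟨2 * K₁ ^ r + C₂ + 1, by positivity, fun f hf M hM hE δ hδ hδ' => ?_⟩
  refine iSup₂_le fun t ht => ?_
  have hpi := Real.pi_pos
  have hn : ∀ k : ℕ, 1 ≤ 2 ^ k := fun k => Nat.one_le_two_pow
  choose P hPdeg hPb using fun k : ℕ =>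
    exists_polynomial_weightedNorm_sub_le (hn k) hM (hE (2 ^ k) (hn k))
  have hPb' : ∀ k : ℕ, weightedNorm p α (fun x => f x - (P k).eval x) ≤
      ENNReal.ofReal (2 * M * (2 ^ k : ℝ) ^ (-lam)) := fun k => by
    simpa using hPb k
  have hPm : ∀ Q : ℝ[X], MemLpWeighted p α fun x => Q.eval x := fun Q =>
    memLpWeighted_polynomial p h.pos.le Q
  -- The degree `2 ^ N` is matched to `δ`.
  obtain ⟨N, hN1, hN2⟩ := exists_nat_pow_near (x := Real.pi / δ) (y := 2)
    (by rw [le_div_iff₀ hδ]; linarith) (by norm_num)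
  have htδ₀ : ∀ j, |t j| ≤ δ₀ := fun j => (ht j).trans hδ'
  have hfirst : weightedNorm p α (genDiff r t fun x => f x - (P N).eval x) ≤
      ENNReal.ofReal (2 * K₁ ^ r * M * δ ^ lam) := by
    refine (hb₁ _ (hf.sub (hPm _)) r t htδ₀).trans ?_
    refine (mul_le_mul' le_rfl (hPb' N)).trans ?_
    rw [← ENNReal.ofReal_mul (by positivity)]
    refine ENNReal.ofReal_le_ofReal ?_
    have hD : δ⁻¹ ≤ (2 : ℝ) ^ N := by
      rw [pow_succ, div_lt_iff₀ hδ] at hN2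
      rw [inv_le_iff_one_le_mul₀ hδ]
      linarith [Real.pi_gt_three]
    have hle : ((2 : ℝ) ^ N) ^ (-lam) ≤ δ ^ lam := by
      calc ((2 : ℝ) ^ N) ^ (-lam) ≤ (δ⁻¹) ^ (-lam) :=
            Real.rpow_le_rpow_of_nonpos (by positivity) hD (by linarith)
        _ = δ ^ lam := by rw [Real.inv_rpow hδ.le, Real.rpow_neg hδ.le, inv_inv]
    calc K₁ ^ r * (2 * M * ((2 : ℝ) ^ N) ^ (-lam)) ≤ K₁ ^ r * (2 * M * δ ^ lam) := by gcongr
      _ = _ := by ring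
  have hstep : ∀ k : ℕ, weightedNorm p α (genDiff r t fun x => (P (k + 1) - P k).eval x) ≤
      ENNReal.ofReal ((K₂ * (2 ^ (k + 1) * δ) ^ 2) ^ r * (4 * M * (2 ^ k : ℝ) ^ (-lam))) :=
    fun k => by
      have hdeg : (P (k + 1) - P k).natDegree ≤ 2 ^ (k + 1) - 1 :=
        (natDegree_sub_le _ _).trans (max_le (hPdeg _) ((hPdeg k).trans
          (Nat.sub_le_sub_right (Nat.pow_le_pow_right (by norm_num) (Nat.le_succ k)) 1)))
      have hcast : ((2 ^ (k + 1) - 1 : ℕ) : ℝ) + 1 = 2 ^ (k + 1) := by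
        rw [Nat.cast_sub (hn _)]; push_cast; ring
      have hnorm : weightedNorm p α (fun x => (P (k + 1) - P k).eval x) ≤
          ENNReal.ofReal (4 * M * (2 ^ k : ℝ) ^ (-lam)) := by
        have e : (fun x => (P (k + 1) - P k).eval x) =
            fun x => (f x - (P k).eval x) - (f x - (P (k + 1)).eval x) := by
          funext x; rw [eval_sub]; ring
        rw [e]
        refine (weightedNorm_sub_le h.1 (hf.sub (hPm _)) (hf.sub (hPm _))).trans ?_
        refine (add_le_add (hPb' k) (hPb' (k + 1))).trans ?_
        rw [← ENNReal.ofReal_add (by positivity) (by positivity)]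
        refine ENNReal.ofReal_le_ofReal ?_
        have hmono : ((2 : ℝ) ^ (k + 1)) ^ (-lam) ≤ (2 ^ k : ℝ) ^ (-lam) :=
          Real.rpow_le_rpow_of_nonpos (by positivity)
            (pow_le_pow_right₀ (by norm_num) (Nat.le_succ k)) (by linarith)
        nlinarith
      have hb := hb₂ _ _ hdeg δ hδ' r t ht
      rw [hcast] at hb
      refine (hb.trans (mul_le_mul' le_rfl hnorm)).trans ?_
      rw [← ENNReal.ofReal_mul (by positivity)]
  have hsum : weightedNorm p α (genDiff r t fun x => (P N).eval x) ≤
      ENNReal.ofReal (C₂ * M * δ ^ lam) := by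
    refine (weightedNorm_genDiff_telescope_le h hr (fun j => (htδ₀ j).trans_lt hδ₀)
      (by simpa using hPdeg 0) N).trans ?_
    refine (Finset.sum_le_sum fun k _ => hstep k).trans ?_
    rw [← ENNReal.ofReal_sum_of_nonneg fun k _ => by positivity]
    exact ENNReal.ofReal_le_ofReal (sum_dyadic_le hK₂ hM.le hlam_lt hδ rfl hN1)
  have e : f = fun x => (f x - (P N).eval x) + (P N).eval x := by
    funext x; ring
  calc weightedNorm p α (genDiff r t f)
      = weightedNorm p α (genDiff r t fun x => (f x - (P N).eval x) + (P N).eval x) := by rw [← e]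
    _ ≤ _ := weightedNorm_genDiff_add_le h (hf.sub (hPm _)) (hPm _) r t
    _ ≤ ENNReal.ofReal (2 * K₁ ^ r * M * δ ^ lam) + ENNReal.ofReal (C₂ * M * δ ^ lam) :=
        add_le_add hfirst hsum
    _ ≤ _ := by
        rw [← ENNReal.ofReal_add (by positivity) (by positivity)]
        refine ENNReal.ofReal_le_ofReal ?_
        have : 0 ≤ M * δ ^ lam := by positivity
        nlinarith

theorem mainTheorem2 (p : ℝ≥0∞) (hp : 1 ≤ p) (α : ℝ)
    (hα : p ≠ ∞ → 1 - 1 / (2 * p.toReal) < α ∧ α < 3 / 2 - 1 / (2 * p.toReal))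
    (hα_top : p = ∞ → 1 ≤ α ∧ α < 3 / 2)
    (r : ℕ) (hr : 1 ≤ r) (lam : ℝ) (hlam : 0 < lam) (hlam_lt : lam < 2 * (r : ℝ))
    (δ₀ : ℝ) (hδ₀ : δ₀ < Real.pi) :
    ∃ C : ℝ, 0 < C ∧
      ∀ f : ℝ → ℝ, MemLpWeighted p α f →
      ∀ M : ℝ, 0 ≤ M →
        (∀ n : ℕ, 1 ≤ n → bestApprox p α n f ≤ ENNReal.ofReal (M * (n : ℝ) ^ (-lam))) →
        ∀ δ : ℝ, 0 < δ → δ ≤ δ₀ →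
          genModulus p α r f δ ≤ ENNReal.ofReal (C * M * δ ^ lam) := by
  obtain ⟨C, hC, hb⟩ := exists_genModulus_le_of_pos ⟨hp, hα, hα_top⟩ hr hlam hlam_lt hδ₀
  refine ⟨C, hC, fun f hf M hM hE δ hδ hδ' => ?_⟩
  -- `M = 0` is reached as a limit of positive `M`, since best approximation need not be attained.
  refine ENNReal.le_of_forall_pos_le_add fun ε hε _ => ?_
  have hδl : 0 < δ ^ lam := Real.rpow_pos_of_pos hδ lam
  set η := (ε : ℝ) / (C * δ ^ lam) with hη
  have hη0 : 0 < η := div_pos (by exact_mod_cast hε) (by positivity)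
  refine (hb f hf (M + η) (by linarith) (fun n hn => (hE n hn).trans ?_) δ hδ hδ').trans ?_
  · refine ENNReal.ofReal_le_ofReal ?_
    gcongr
    linarith
  · have e : C * (M + η) * δ ^ lam = C * M * δ ^ lam + ε := by
      rw [hη]; field_simp
    rw [e, ENNReal.ofReal_add (by positivity) ε.coe_nonneg, ENNReal.ofReal_coe_nnreal]
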